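/- Let $d\ge 0$. A *pure $d$-dimensional orthogonal polytope* is a finite union $P\subset\mathbb R^d$ of boxes $\prod_{i=1}^d[a_i,b_i]$ with $a_i<b_i$ for all $i$. For $s\in\{\pm1\}^d$ let $\Omega_s=\{x: s_ix_i\ge 0\ \text{for all } i\}$; the *tangent cone* of $P$ at $v$ is the unique union $\alpha$ of such orthants with $P\cap(v+[-\delta,\delta]^d)=v+(\alpha\cap[-\delta,\delta]^d)$ for some $\delta>0$. Two such unions are *congruent* if a signed permutation of the coordinates maps one onto the other. The *genericity region* of $v\in P$ is the set of all points that can be joined to $v$ by a path in $P$ along which every tangent cone is congruent to the tangent cone at $v$. Its *degree* is the smallest dimension of a generalized hyperplane $\{x: x_i=c_i\ \text{for } i\in I\}$, $I\subseteq\{1,\dots,d\}$ (of dimension $d-|I|$), that contains it. The *vertices* (singular points) of $P$ are the points whose genericity region has degree $0$; a *$k$-dimensional face* is the closure of a genericity region of degree $k$; an *edge* is a $1$-dimensional face. A *signed series-parallel diagram* $(\Delta,s)$ is built from single edges, each with a label in $\{1,\dots,d\}$ and a sign $\pm1$, by series connection $\wedge$ and parallel connection $\vee$; the diagram with a single vertex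 and no edge is also admitted on its own. Its arrangement is obtained by reading the edge labelled $i$ with sign $s_i$ as the half-space $\{x: s_ix_i\ge0\}$, $\wedge$ as intersection and $\vee$ as union (and the diagram without edges as the whole space). A *floral vertex on $d$ half-spaces* is the arrangement of a signed diagram in which every label $1,\dots,d$ occurs exactly once. The *signed volume* of a signed diagram is given by $\tau=s_i$ on the single edge $i$, $\tau(\Delta_1\wedge\Delta_2)=\tau(\Delta_1)\tau(\Delta_2)$ and $\tau(\Delta_1\vee\Delta_2)=-\tau(\Delta_1)\tau(\Delta_2)$ (and $\tau=1$ for the diagram without edges). For a union $\alpha$ of orthants let $\tau_d(\alpha)=\sum_{\Omega_s\subseteq\alpha}\prod_i s_i$. A *generic orthotope* of dimension $d$ is a pure $d$-dimensional orthogonal polytope whose tangent cone at every vertex is a floral vertex on $d$ half-spaces. **Proposition.** Let $P\subset\mathbb R^d$ be a generic orthotope. Then the $1$-dimensional skeleton of $P$ is a bipartite $d$-regular graph. That is: every edge of $P$ is a line segment joining two distinct vertices of $P$ and containing no other vertex of $P$; and the graph on the vertices of $P$, in which two distinct vertices are adjacent when they lie on a common edge of $P$, is bipartite, and every vertex has exactly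 $d$ neighbours. Moreover, for every vertex $v$ with tangent cone $\alpha_v$, every signed diagram that determines $\alpha_v$ as a floral vertex has the same signed volume $\tau(v)=\tau_d(\alpha_v)\in\{1,-1\}$; adjacent vertices $v,w$ satisfy $\tau(v)+\tau(w)=0$; hence $\{v:\tau(v)=1\}$ and $\{v:\tau(v)=-1\}$ form a bipartition of the graph. -/

import Mathlib

namespace Orthotope

/-! ## Orthogonal polytopes -/

/-- A pure `d`-dimensional orthogonal polytope: a finite union of axis-aligned boxes
`∏ [aᵢ, bᵢ]` with `aᵢ < bᵢ` for all `i`. -/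
def IsPureOrthogonalPolytope {d : ℕ} (P : Set (Fin d → ℝ)) : Prop :=
  ∃ S : Finset ((Fin d → ℝ) × (Fin d → ℝ)),
    (∀ B ∈ S, ∀ i, B.1 i < B.2 i) ∧ P = ⋃ B ∈ S, Set.Icc B.1 B.2

/-- The generalized hyperplane `{x | xᵢ = cᵢ for all i ∈ I}`, of dimension `d - |I|`. -/
def generalizedHyperplane {d : ℕ} (I : Finset (Fin d)) (c : Fin d → ℝ) : Set (Fin d → ℝ) :=
  {x | ∀ i ∈ I, x i = c i}

/-! ## Local orthotopal arrangements and tangent cones -/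

/-- The closed orthant `{x | sᵢ xᵢ ≥ 0 for all i}` represented by the sign vector `s`. -/
def orthant {d : ℕ} (s : Fin d → ℤˣ) : Set (Fin d → ℝ) :=
  {x | ∀ i, 0 ≤ ((s i : ℤ) : ℝ) * x i}

/-- A local orthotopal arrangement: a union of closed orthants. -/
def IsLocalArrangement {d : ℕ} (α : Set (Fin d → ℝ)) : Prop :=
  ∃ S : Set (Fin d → ℤˣ), α = ⋃ s ∈ S, orthant s

/-- `α` is a tangent cone of `P` at `v`: a local orthotopal arrangement such that, for some
`δ > 0`, the set `P ∩ (v + [-δ, δ]^d)` equals `v + (α ∩ [-δ, δ]^d)`. -/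
def IsTangentCone {d : ℕ} (P : Set (Fin d → ℝ)) (v : Fin d → ℝ) (α : Set (Fin d → ℝ)) : Prop :=
  IsLocalArrangement α ∧
    ∃ δ : ℝ, 0 < δ ∧ ∀ x : Fin d → ℝ, (∀ i, |x i| ≤ δ) → (v + x ∈ P ↔ x ∈ α)

/-- The tangent cone of `P` at `v`, that is, the unique `α` with `IsTangentCone P v α`
(see `IsTangentCone.tangentCone_eq` and `IsPureOrthogonalPolytope.isTangentCone`). -/
def tangentCone {d : ℕ} (P : Set (Fin d → ℝ)) (v : Fin d → ℝ) : Set (Fin d → ℝ) :=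
  ⋃₀ {α | IsTangentCone P v α}

theorem IsLocalArrangement.smul_mem_iff {d : ℕ} {α : Set (Fin d → ℝ)}
    (h : IsLocalArrangement α) {t : ℝ} (ht : 0 < t) (x : Fin d → ℝ) :
    t • x ∈ α ↔ x ∈ α := by
  obtain ⟨S, rfl⟩ := h
  have key : ∀ (s : Fin d → ℤˣ), t • x ∈ orthant s ↔ x ∈ orthant s := by
    intro s
    refine forall_congr' fun i => ?_
    have : ((s i : ℤ) : ℝ) * (t • x) i = t * (((s i : ℤ) : ℝ) * x i) := by
      simp only [Pi.smul_apply, smul_eq_mul]; ring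
    rw [this]
    exact mul_nonneg_iff_of_pos_left ht
  simp only [Set.mem_iUnion, key]

theorem exists_pos_smul_le {d : ℕ} (x : Fin d → ℝ) {δ : ℝ} (hδ : 0 < δ) :
    ∃ t : ℝ, 0 < t ∧ ∀ i, |(t • x) i| ≤ δ := by
  refine ⟨δ / (‖x‖ + 1), by positivity, fun i => ?_⟩
  have h1 : |x i| ≤ ‖x‖ := norm_le_pi_norm x i
  have h0 : (0 : ℝ) < ‖x‖ + 1 := by positivity
  rw [Pi.smul_apply, smul_eq_mul, abs_mul, abs_of_pos (by positivity), div_mul_eq_mul_div,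
    div_le_iff₀ h0]
  nlinarith

theorem IsTangentCone.unique {d : ℕ} {P : Set (Fin d → ℝ)} {v : Fin d → ℝ}
    {α β : Set (Fin d → ℝ)} (hα : IsTangentCone P v α) (hβ : IsTangentCone P v β) : α = β := by
  obtain ⟨hα, δ, hδ, h⟩ := hα
  obtain ⟨hβ, ε, hε, k⟩ := hβ
  ext x
  obtain ⟨t, ht, hx⟩ := exists_pos_smul_le x (lt_min hδ hε)
  rw [← hα.smul_mem_iff ht, ← hβ.smul_mem_iff ht,
    ← h _ fun i => (hx i).trans (min_le_left _ _), ← k _ fun i => (hx i).trans (min_le_right _ _)]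

theorem IsTangentCone.tangentCone_eq {d : ℕ} {P : Set (Fin d → ℝ)} {v : Fin d → ℝ}
    {α : Set (Fin d → ℝ)} (h : IsTangentCone P v α) : tangentCone P v = α := by
  have : {β | IsTangentCone P v β} = {α} := by
    ext β
    exact ⟨fun hβ => hβ.unique h, fun hβ => by rw [Set.mem_singleton_iff.1 hβ]; exact h⟩
  rw [tangentCone, this, Set.sUnion_singleton]

theorem isTangentCone_box {d : ℕ} (a b v : Fin d → ℝ) (hab : ∀ i, a i < b i) :
    ∃ α, IsTangentCone (Set.Icc a b) v α := by
  by_cases hv : v ∈ Set.Icc a b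
  · have hgap : ∀ i : Fin d, ∃ δ : ℝ, 0 < δ ∧ (a i < v i → δ ≤ v i - a i) ∧
        (v i < b i → δ ≤ b i - v i) := by
      intro i
      have h1 := hv.1 i
      have h2 := hv.2 i
      rcases h1.eq_or_lt with h | h
      · exact ⟨b i - a i, by linarith [hab i], fun h' => by linarith, fun _ => by linarith⟩
      · rcases h2.eq_or_lt with h' | h'
        · exact ⟨v i - a i, by linarith, fun _ => le_rfl, fun h'' => by linarith⟩
        · exact ⟨min (v i - a i) (b i - v i), lt_min (by linarith) (by linarith),
            fun _ => min_le_left _ _, fun _ => min_le_right _ _⟩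
    choose g hg0 hga hgb using hgap
    refine ⟨⋃ s ∈ {s : Fin d → ℤˣ | ∀ i, (v i = a i → s i = 1) ∧ (v i = b i → s i = -1)},
      orthant s, ⟨_, rfl⟩, ?_⟩
    have hmin : ∃ δ : ℝ, 0 < δ ∧ ∀ i, δ ≤ g i := by
      rcases isEmpty_or_nonempty (Fin d) with hd | hd
      · exact ⟨1, one_pos, fun i => hd.elim i⟩
      · obtain ⟨j, hj⟩ := Finite.exists_min g
        exact ⟨g j, hg0 j, hj⟩
    obtain ⟨δ, hδ, hle⟩ := hmin
    refine ⟨δ, hδ, fun x hx => ?_⟩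
    simp only [Set.mem_iUnion, Set.mem_ofPred_eq, exists_prop, orthant]
    constructor
    · rintro ⟨h1, h2⟩
      refine ⟨fun i => if v i = a i then 1 else if v i = b i then -1 else
        if 0 ≤ x i then 1 else -1, fun i => ⟨fun h => by simp [h], fun h => ?_⟩, fun i => ?_⟩
      · simp [h, (hab i).ne']
      · have h1 := h1 i
        have h2 := h2 i
        simp only [Pi.add_apply] at h1 h2
        dsimp only
        split_ifs <;> simp <;> linarith
    · rintro ⟨s, hs, hsx⟩
      have hb : ∀ i, a i ≤ v i + x i ∧ v i + x i ≤ b i := by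
        intro i
        have hxi := abs_le.1 ((hx i).trans (hle i))
        have hsi := hsx i
        constructor
        · rcases (hv.1 i).eq_or_lt with h | h
          · rw [(hs i).1 h.symm] at hsi
            simp at hsi; linarith
          · linarith [hga i h]
        · rcases (hv.2 i).eq_or_lt with h | h
          · rw [(hs i).2 h] at hsi
            simp at hsi; linarith
          · linarith [hgb i h]
      exact ⟨fun i => (hb i).1, fun i => (hb i).2⟩
  · refine ⟨∅, ⟨∅, by simp⟩, ?_⟩
    obtain ⟨ε, hε, h⟩ := Metric.isOpen_iff.1 (isClosed_Icc (a := a) (b := b)).isOpen_compl v hv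
    refine ⟨ε / 2, by positivity, fun x hx => ?_⟩
    simp only [Set.mem_empty_iff_false, iff_false]
    refine h ?_
    rw [Metric.mem_ball, dist_eq_norm, add_sub_cancel_left]
    exact ((pi_norm_le_iff_of_nonneg (by positivity)).2 hx).trans_lt (by linarith)

theorem IsPureOrthogonalPolytope.isTangentCone {d : ℕ} {P : Set (Fin d → ℝ)}
    (hP : IsPureOrthogonalPolytope P) (v : Fin d → ℝ) : IsTangentCone P v (tangentCone P v) := by
  suffices h : ∃ α, IsTangentCone P v α by
    obtain ⟨α, hα⟩ := h
    rwa [hα.tangentCone_eq]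
  obtain ⟨S, hS, rfl⟩ := hP
  induction S using Finset.cons_induction with
  | empty => exact ⟨∅, ⟨∅, by simp⟩, 1, one_pos, by simp⟩
  | cons B S hB ih =>
    obtain ⟨α, ⟨A, rfl⟩, δ, hδ, h⟩ := ih fun B hB => hS B (Finset.mem_cons_of_mem hB)
    obtain ⟨β, ⟨A', rfl⟩, ε, hε, k⟩ :=
      isTangentCone_box B.1 B.2 v (hS B (Finset.mem_cons_self B S))
    refine ⟨_, ⟨A' ∪ A, rfl⟩, min δ ε, lt_min hδ hε, fun x hx => ?_⟩
    have h := h x fun i => (hx i).trans (min_le_left _ _)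
    have k := k x fun i => (hx i).trans (min_le_right _ _)
    rw [Set.biUnion_union, Set.mem_union, ← h, ← k]
    simp only [Set.mem_iUnion, Finset.mem_cons, exists_prop, or_and_right, exists_or,
      exists_eq_left]

/-- Congruence of arrangements: `β` is the image of `α` under a symmetry of the cube
`[-1, 1]^d`, that is, under a signed permutation of the coordinates. -/
def Congruent {d : ℕ} (α β : Set (Fin d → ℝ)) : Prop :=
  ∃ (f : Equiv.Perm (Fin d)) (s : Fin d → ℤˣ),
    β = (fun (x : Fin d → ℝ) (i : Fin d) => ((s i : ℤ) : ℝ) * x (f i)) '' α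

/-! ## Genericity regions and faces -/

/-- The genericity region of `v` in `P`: all points that can be joined to `v` by a path in `P`
along which every tangent cone is congruent to the tangent cone at `v`. -/
def genericityRegion {d : ℕ} (P : Set (Fin d → ℝ)) (v : Fin d → ℝ) : Set (Fin d → ℝ) :=
  {w | ∃ γ : Path v w, ∀ t, γ t ∈ P ∧ Congruent (tangentCone P v) (tangentCone P (γ t))}

/-- The degree (dimension) of a region: the smallest dimension of a generalized hyperplane
that contains it. -/
noncomputable def regionDegree {d : ℕ} (R : Set (Fin d → ℝ)) : ℕ :=
  sInf {k | ∃ (I : Finset (Fin d)) (c : Fin d → ℝ), k = d - I.card ∧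
    R ⊆ generalizedHyperplane I c}

/-- The singular points (vertices) of `P`: the points whose genericity region has degree `0`. -/
def singularPoints {d : ℕ} (P : Set (Fin d → ℝ)) : Set (Fin d → ℝ) :=
  {v | v ∈ P ∧ regionDegree (genericityRegion P v) = 0}

/-- `F` is a `k`-dimensional face of `P`: the closure of a `k`-dimensional genericity region. -/
def IsFace {d : ℕ} (P : Set (Fin d → ℝ)) (k : ℕ) (F : Set (Fin d → ℝ)) : Prop :=
  ∃ v ∈ P, regionDegree (genericityRegion P v) = k ∧ F = closure (genericityRegion P v)

/-! ## Signed series-parallel diagrams and floral vertices -/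

/-- Parse trees of signed series-parallel diagrams with at least one edge; each edge carries a
label in `Fin d` and a sign. -/
inductive SignedSPD (d : ℕ) : Type
  | edge (i : Fin d) (s : ℤˣ) : SignedSPD d
  | series (D₁ D₂ : SignedSPD d) : SignedSPD d
  | parallel (D₁ D₂ : SignedSPD d) : SignedSPD d

namespace SignedSPD

/-- The edge labels, with multiplicity. -/
def edges {d : ℕ} : SignedSPD d → Multiset (Fin d)
  | edge i _ => {i}
  | series D₁ D₂ => D₁.edges + D₂.edges
  | parallel D₁ D₂ => D₁.edges + D₂.edges

/-- Series connection is intersection, parallel connection is union, and the edge `i` with sign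
`s` is the closed half-space `s xᵢ ≥ 0`. -/
def arrangement {d : ℕ} : SignedSPD d → Set (Fin d → ℝ)
  | edge i s => {x | 0 ≤ ((s : ℤ) : ℝ) * x i}
  | series D₁ D₂ => D₁.arrangement ∩ D₂.arrangement
  | parallel D₁ D₂ => D₁.arrangement ∪ D₂.arrangement

/-- The dual signed diagram: series and parallel are interchanged, all signs are negated. -/
def dual {d : ℕ} : SignedSPD d → SignedSPD d
  | edge i s => edge i (-s)
  | series D₁ D₂ => parallel D₁.dual D₂.dual
  | parallel D₁ D₂ => series D₁.dual D₂.dual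

/-- The signed volume `τ` of a signed diagram: `1` on a positive edge, multiplicative under
series connection, and negated under duality (see `tau_dual`). -/
def tau {d : ℕ} : SignedSPD d → ℤ
  | edge _ s => s
  | series D₁ D₂ => D₁.tau * D₂.tau
  | parallel D₁ D₂ => -(D₁.tau * D₂.tau)

theorem tau_dual {d : ℕ} (D : SignedSPD d) : D.dual.tau + D.tau = 0 := by
  induction D with
  | edge i s => simp [dual, tau]
  | series D₁ D₂ h₁ h₂ =>
    simp only [dual, tau, eq_neg_of_add_eq_zero_left h₁, eq_neg_of_add_eq_zero_left h₂]; ring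
  | parallel D₁ D₂ h₁ h₂ =>
    simp only [dual, tau, eq_neg_of_add_eq_zero_left h₁, eq_neg_of_add_eq_zero_left h₂]; ring

end SignedSPD

/-- Signed series-parallel diagrams, including the honorary diagram that consists of a single
vertex and has no edges. -/
inductive SignedDiagram (d : ℕ) : Type
  | point : SignedDiagram d
  | proper (D : SignedSPD d) : SignedDiagram d

namespace SignedDiagram

def edges {d : ℕ} : SignedDiagram d → Multiset (Fin d)
  | point => 0
  | proper D => D.edges

def arrangement {d : ℕ} : SignedDiagram d → Set (Fin d → ℝ)
  | point => Set.univ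
  | proper D => D.arrangement

def tau {d : ℕ} : SignedDiagram d → ℤ
  | point => 1
  | proper D => D.tau

/-- The diagram `D` determines `α` as a floral vertex on `d` half-spaces: every label in
`Fin d` is used exactly once, and `α` is the arrangement of `D`. -/
def IsFloralDiagramOf {d : ℕ} (D : SignedDiagram d) (α : Set (Fin d → ℝ)) : Prop :=
  D.edges = Finset.univ.val ∧ D.arrangement = α

end SignedDiagram

/-- A floral vertex on `d` half-spaces in `ℝ^d`. -/
def IsFloralVertex {d : ℕ} (α : Set (Fin d → ℝ)) : Prop :=
  ∃ D : SignedDiagram d, D.IsFloralDiagramOf α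

open Classical in
/-- The signed volume `τ_d(α)`: the sum of the signs `∏ sᵢ` of the orthants occupied by `α`. -/
noncomputable def signedVolume {d : ℕ} (α : Set (Fin d → ℝ)) : ℤ :=
  ∑ s : Fin d → ℤˣ, if orthant s ⊆ α then ((∏ i, s i : ℤˣ) : ℤ) else 0

/-! ## Generic orthotopes and their 1-skeleton -/

/-- A generic orthotope of dimension `d`: a pure `d`-dimensional orthogonal polytope such that
the tangent cone at every singular point is a floral vertex on `d` half-spaces. -/
def IsGenericOrthotope {d : ℕ} (P : Set (Fin d → ℝ)) : Prop :=
  IsPureOrthogonalPolytope P ∧ ∀ v ∈ singularPoints P, IsFloralVertex (tangentCone P v)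

/-- The 1-dimensional skeleton of `P` as a graph: its vertices are the singular points of `P`,
and two different vertices are adjacent if they lie on a common 1-dimensional face. -/
def skeleton {d : ℕ} (P : Set (Fin d → ℝ)) : SimpleGraph (singularPoints P) where
  Adj v w := v ≠ w ∧ ∃ E, IsFace P 1 E ∧ (v : Fin d → ℝ) ∈ E ∧ (w : Fin d → ℝ) ∈ E
  symm := ⟨fun _ _ h => ⟨h.1.symm, h.2.imp fun _ hE => ⟨hE.1, hE.2.2, hE.2.1⟩⟩⟩
  loopless := ⟨fun _ h => h.1 rfl⟩

end Orthotope

/-!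
Write `C v` for the tangent cone of `P` at `v`, a union of orthants, and identify it with the set
of its sign vectors. Call a coordinate *essential* for a cone if membership depends on it.

Near `v` the tangent cone at `w` is the tangent cone of `C v` at `w - v`, whose essential
coordinates are among those of `C v` at which `w` and `v` agree. Since the number of essential
coordinates is invariant under congruence, a path inside a genericity region keeps the essential
coordinates and the tangent cone constant (`constant_along_path`). Hence the degree of the region
of `v` is the number of inessential coordinates of `C v` (`regionDegree_genericityRegion`); the
vertices are the points with all coordinates essential, and if exactly one coordinate `j` is
inessential, the region is a bounded open segment in direction `j`, at whose ends `j` has to become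
essential (`exists_genericityRegion_eq_openSegment`). So edges join two vertices, and an edge
leaves the vertex `v` in direction `σ` along axis `j` exactly when the half of `C v` on this side
is nonempty and depends on all other coordinates (`exists_adj_of_not_isThin`).

For a floral vertex the last condition holds for exactly one of the two signs `σ`
(`IsFloralVertex.existsUnique_not_isThin`). Fixing the sign at the label `j` to the value that
decides the connection of `j` with its sibling subtree makes the labels of that subtree irrelevant,
so one side is degenerate, and a degenerate side contributes `0` to the signed volume, since sign
vectors cancel in pairs. As the signed volume is the `τ` of the diagram, which is a sign
(`SignedSPD.two_pow_mul_sum_weight`), the other side contributes all of it and is nondegenerate.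
This gives `d` neighbours. The two ends of an edge see the same half cone on opposite sides, so
their signed volumes are opposite.
-/

namespace Orthotope

open Function

/-! ### Free coordinates -/

/-- The coordinate `i` is free in `A` if membership in `A` does not depend on it. -/
def IsFree {ι κ : Type*} [DecidableEq ι] (A : Set (ι → κ)) (i : ι) : Prop :=
  ∀ x ∈ A, ∀ t, update x i t ∈ A

namespace IsFree

variable {ι κ : Type*} [DecidableEq ι] {A B : Set (ι → κ)} {i : ι}

theorem update_mem_iff (h : IsFree A i) (x : ι → κ) (t : κ) : update x i t ∈ A ↔ x ∈ A :=
  ⟨fun hx => by simpa using h _ hx (x i), fun hx => h x hx t⟩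

theorem inter (hA : IsFree A i) (hB : IsFree B i) : IsFree (A ∩ B) i :=
  fun x hx t => ⟨hA x hx.1 t, hB x hx.2 t⟩

theorem union (hA : IsFree A i) (hB : IsFree B i) : IsFree (A ∪ B) i :=
  fun x hx t => hx.imp (fun h => hA x h t) fun h => hB x h t

/-- Changing any finite set of free coordinates preserves membership. -/
theorem mem_of_eqOn {T : Finset ι} (hT : ∀ i ∈ T, IsFree A i) {x y : ι → κ} (hx : x ∈ A)
    (hxy : ∀ i ∉ T, x i = y i) : y ∈ A := by
  induction T using Finset.induction_on generalizing x with
  | empty => rwa [← show x = y from funext fun i => hxy i (Finset.notMem_empty i)]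
  | insert a T _ ih =>
    refine ih (fun i hi => hT i (Finset.mem_insert_of_mem hi))
      (hT a (Finset.mem_insert_self a T) x hx (y a)) fun i hi => ?_
    by_cases hia : i = a
    · subst hia; simp
    · rw [update_of_ne hia]
      exact hxy i (by simp [hia, hi])

end IsFree

theorem isFree_of_dependsOn {ι κ : Type*} [DecidableEq ι] {A : Set (ι → κ)} {S : Set ι}
    (h : DependsOn (· ∈ A) S) {i : ι} (hi : i ∉ S) : IsFree A i := by
  intro x hx t
  have : (x ∈ A) = (update x i t ∈ A) := h fun k hk => by
    rw [update_of_ne]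
    rintro rfl
    exact hi hk
  exact this ▸ hx

/-! ### Sums over sign vectors -/

/-- Functions of disjoint sets of coordinates are independent for the uniform distribution. -/
theorem card_mul_sum_mul_eq {ι κ : Type*} [Fintype ι] [DecidableEq ι] [Fintype κ]
    {f g : (ι → κ) → ℤ} {S T : Set ι} (hST : Disjoint S T) (hf : DependsOn f S)
    (hg : DependsOn g T) :
    (Fintype.card (ι → κ) : ℤ) * ∑ x, f x * g x = (∑ x, f x) * ∑ x, g x := by
  classical
  -- exchanging the coordinates in `S` is an involution on pairs of points
  have hinv : Involutive fun p : (ι → κ) × (ι → κ) =>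
      (S.piecewise p.1 p.2, S.piecewise p.2 p.1) := by
    rintro ⟨x, y⟩
    ext i <;> by_cases hi : i ∈ S <;> simp [hi]
  rw [Fintype.sum_mul_sum, ← Fintype.sum_prod_type']
  calc _ = ∑ p : (ι → κ) × (ι → κ), f p.1 * g p.1 := by
        rw [Fintype.sum_prod_type, Finset.sum_comm]
        simp
    _ = ∑ p : (ι → κ) × (ι → κ), f (S.piecewise p.1 p.2) * g (S.piecewise p.1 p.2) :=
        (Equiv.sum_comp hinv.toPerm fun p => f p.1 * g p.1).symm
    _ = _ := by
        refine Finset.sum_congr rfl fun p _ => ?_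
        congr 1
        · exact hf fun i hi => Set.piecewise_eq_of_mem _ _ _ hi
        · exact hg fun i hi => Set.piecewise_eq_of_notMem _ _ _ (Set.disjoint_right.1 hST hi)

variable {d : ℕ}

/-- Reversal of the sign of the coordinate `k`. -/
def flip (k : Fin d) : Equiv.Perm (Fin d → ℤˣ) :=
  Involutive.toPerm (fun s => update s k (-s k)) fun s => by simp

theorem flip_apply (k : Fin d) (s : Fin d → ℤˣ) : flip k s = update s k (-s k) := rfl

theorem sum_eq_zero_of_flip {F : (Fin d → ℤˣ) → ℤ} (k : Fin d)
    (h : ∀ s, F (flip k s) = -F s) : ∑ s, F s = 0 := by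
  have := Equiv.sum_comp (flip k) F
  simp only [h, Finset.sum_neg_distrib] at this
  lia

theorem prod_flip (k : Fin d) (s : Fin d → ℤˣ) : ∏ i, flip k s i = -∏ i, s i := by
  rw [flip_apply, Finset.prod_update_of_mem (Finset.mem_univ k),
    ← Finset.mul_prod_erase _ s (Finset.mem_univ k), Finset.sdiff_singleton_eq_erase, neg_mul]

/-! ### Halves of a set of sign vectors -/

/-- The restriction of `A` to the sign vectors with `j`-th sign `σ`, extended so that `j` becomes
a free coordinate. -/
def half (A : Set (Fin d → ℤˣ)) (j : Fin d) (σ : ℤˣ) : Set (Fin d → ℤˣ) :=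
  {s | update s j σ ∈ A}

/-- A set of sign vectors is thin away from `j` if it is empty or has a free coordinate other than
`j`. -/
def IsThin (A : Set (Fin d → ℤˣ)) (j : Fin d) : Prop :=
  A = ∅ ∨ ∃ k ≠ j, IsFree A k

theorem IsFree.half {A : Set (Fin d → ℤˣ)} {j k : Fin d} (h : IsFree A k) (hkj : k ≠ j) (σ : ℤˣ) :
    IsFree (half A j σ) k := fun s hs t => by
  change update (update s k t) j σ ∈ A
  rw [update_comm hkj]
  exact h _ hs t

open Classical in
/-- The contribution of the sign vectors with `j`-th sign `σ` to the signed volume of `A`. -/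
noncomputable def halfVolume (A : Set (Fin d → ℤˣ)) (j : Fin d) (σ : ℤˣ) : ℤ :=
  ∑ s : Fin d → ℤˣ, if s j = σ ∧ s ∈ A then ((∏ i, s i : ℤˣ) : ℤ) else 0

theorem mem_half_of_eq {A : Set (Fin d → ℤˣ)} {j : Fin d} {σ : ℤˣ} {s : Fin d → ℤˣ}
    (h : s j = σ) : s ∈ half A j σ ↔ s ∈ A := by
  subst h
  simp [half]

/-- A thin half contributes nothing: reversing the sign at a free coordinate pairs the sign vectors
of the half into pairs with opposite signs. -/
theorem halfVolume_eq_zero {A : Set (Fin d → ℤˣ)} {j : Fin d} {σ : ℤˣ}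
    (h : IsThin (half A j σ) j) : halfVolume A j σ = 0 := by
  classical
  have hh : ∀ s : Fin d → ℤˣ, (s j = σ ∧ s ∈ A) ↔ (s j = σ ∧ s ∈ half A j σ) :=
    fun s => and_congr_right fun hs => (mem_half_of_eq hs).symm
  simp only [halfVolume, hh]
  rcases h with h | ⟨k, hkj, hk⟩
  · simp [h]
  · refine sum_eq_zero_of_flip k fun s => ?_
    have h1 : flip k s j = s j := by rw [flip_apply, update_of_ne hkj.symm]
    have h2 : flip k s ∈ half A j σ ↔ s ∈ half A j σ := hk.update_mem_iff s _
    rw [prod_flip, h1]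
    simp only [h2]
    split_ifs <;> simp

open Classical in
theorem halfVolume_add_halfVolume_neg (A : Set (Fin d → ℤˣ)) (j : Fin d) (σ : ℤˣ) :
    halfVolume A j σ + halfVolume A j (-σ) =
      ∑ s : Fin d → ℤˣ, if s ∈ A then ((∏ i, s i : ℤˣ) : ℤ) else 0 := by
  rw [halfVolume, halfVolume, ← Finset.sum_add_distrib]
  refine Finset.sum_congr rfl fun s _ => ?_
  by_cases hs : s ∈ A <;> simp only [hs, and_true, and_false, if_true, if_false, add_zero]
  rcases Int.units_eq_one_or (s j) with h | h <;> rcases Int.units_eq_one_or σ with h' | h' <;>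
    simp [h, h']

/-- Equal halves on opposite sides of `j` contribute opposite amounts. -/
theorem halfVolume_eq_neg {A B : Set (Fin d → ℤˣ)} {j : Fin d} {σ : ℤˣ}
    (h : half A j σ = half B j (-σ)) : halfVolume A j σ = -halfVolume B j (-σ) := by
  classical
  rw [halfVolume, halfVolume, ← Equiv.sum_comp (flip j), ← Finset.sum_neg_distrib]
  refine Finset.sum_congr rfl fun s _ => ?_
  have h1 : (flip j s j = σ) ↔ s j = -σ := by
    rw [flip_apply, update_self, neg_eq_iff_eq_neg]
  have h2 : (flip j s j = σ ∧ flip j s ∈ A) ↔ (s j = -σ ∧ s ∈ B) := by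
    rw [h1]
    refine and_congr_right fun hs => ?_
    rw [← mem_half_of_eq (h1.2 hs), h, ← mem_half_of_eq hs]
    simp [half, flip_apply]
  rw [prod_flip]
  simp only [h2]
  split_ifs <;> simp

/-! ### Arrangements as sets of sign vectors -/

/-- The sign vector `s` as a point of `ℝ^d`, an interior point of the orthant of `s`. -/
def signPoint (s : Fin d → ℤˣ) : Fin d → ℝ := fun i => ((s i : ℤ) : ℝ)

/-- The sign vectors of the orthants that make up the arrangement `α`. -/
def signs (α : Set (Fin d → ℝ)) : Set (Fin d → ℤˣ) := {s | signPoint s ∈ α}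

/-- The union of the orthants with sign vectors in `A`. -/
def coneOf (A : Set (Fin d → ℤˣ)) : Set (Fin d → ℝ) := ⋃ s ∈ A, orthant s

theorem mem_coneOf {A : Set (Fin d → ℤˣ)} {x : Fin d → ℝ} :
    x ∈ coneOf A ↔ ∃ s ∈ A, x ∈ orthant s := by
  simp [coneOf]

theorem unit_mul_unit_nonneg {a b : ℤˣ} : 0 ≤ ((a : ℤ) : ℝ) * ((b : ℤ) : ℝ) ↔ a = b := by
  rcases Int.units_eq_one_or a with rfl | rfl <;> rcases Int.units_eq_one_or b with rfl | rfl <;>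
    norm_num

theorem signPoint_mem_orthant {s t : Fin d → ℤˣ} : signPoint s ∈ orthant t ↔ t = s :=
  ⟨fun h => funext fun i => unit_mul_unit_nonneg.1 (h i),
    fun h i => unit_mul_unit_nonneg.2 (congrFun h i)⟩

theorem signPoint_update (s : Fin d → ℤˣ) (i : Fin d) (e : ℤˣ) :
    signPoint (update s i e) = update (signPoint s) i ((e : ℤ) : ℝ) := by
  ext k
  by_cases h : k = i
  · subst h; simp [signPoint]
  · simp [signPoint, h]

@[simp] theorem signs_coneOf (A : Set (Fin d → ℤˣ)) : signs (coneOf A) = A := by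
  ext s
  simp [signs, mem_coneOf, signPoint_mem_orthant]

theorem isLocalArrangement_coneOf (A : Set (Fin d → ℤˣ)) : IsLocalArrangement (coneOf A) :=
  ⟨A, rfl⟩

namespace IsLocalArrangement

variable {α : Set (Fin d → ℝ)}

theorem coneOf_signs (h : IsLocalArrangement α) : coneOf (signs α) = α := by
  obtain ⟨S, rfl⟩ := h
  exact congrArg coneOf (signs_coneOf S)

theorem mem_iff (h : IsLocalArrangement α) {x : Fin d → ℝ} :
    x ∈ α ↔ ∃ s ∈ signs α, x ∈ orthant s := by
  rw [← mem_coneOf, h.coneOf_signs]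

theorem orthant_subset_iff (h : IsLocalArrangement α) {s : Fin d → ℤˣ} :
    orthant s ⊆ α ↔ s ∈ signs α :=
  ⟨fun hs => hs (signPoint_mem_orthant.2 rfl), fun hs _ hx => h.mem_iff.2 ⟨s, hs, hx⟩⟩

theorem signs_eq_empty (h : IsLocalArrangement α) : signs α = ∅ ↔ α = ∅ := by
  refine ⟨fun h' => ?_, fun h' => ?_⟩
  · rw [← h.coneOf_signs, h']; simp [coneOf]
  · rw [h']; rfl

open Classical in
theorem signedVolume_eq (h : IsLocalArrangement α) :
    signedVolume α = ∑ s : Fin d → ℤˣ, if s ∈ signs α then ((∏ i, s i : ℤˣ) : ℤ) else 0 := by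
  simp only [signedVolume, h.orthant_subset_iff]

theorem signedVolume_eq_halfVolume (h : IsLocalArrangement α) (j : Fin d) (σ : ℤˣ) :
    signedVolume α = halfVolume (signs α) j σ + halfVolume (signs α) j (-σ) := by
  rw [h.signedVolume_eq, halfVolume_add_halfVolume_neg]

theorem isFree_signs (h : IsLocalArrangement α) (i : Fin d) :
    IsFree (signs α) i ↔ IsFree α i := by
  refine ⟨fun hi x hx t => ?_, fun hi s hs e => ?_⟩
  · obtain ⟨s, hs, hxs⟩ := h.mem_iff.1 hx
    refine h.mem_iff.2 ⟨update s i (if 0 ≤ t then 1 else -1), hi s hs _, fun k => ?_⟩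
    by_cases hk : k = i
    · subst hk
      simp only [update_self]
      split_ifs with ht
      · simpa using ht
      · simpa using (not_le.1 ht).le
    · simpa [hk] using hxs k
  · change signPoint _ ∈ α
    rw [signPoint_update]
    exact hi _ hs _

end IsLocalArrangement

/-! ### Floral vertices -/

namespace SignedSPD

theorem mem_signs_edge {i : Fin d} {e : ℤˣ} {s : Fin d → ℤˣ} :
    s ∈ signs (edge i e).arrangement ↔ s i = e :=
  unit_mul_unit_nonneg.trans eq_comm

theorem edges_ne_zero (D : SignedSPD d) : ∃ k, k ∈ D.edges := by
  induction D with
  | edge i e => exact ⟨i, by simp [edges]⟩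
  | series D₁ D₂ h _ => exact h.imp fun k hk => Multiset.mem_add.2 (Or.inl hk)
  | parallel D₁ D₂ h _ => exact h.imp fun k hk => Multiset.mem_add.2 (Or.inl hk)

theorem dependsOn_signs (D : SignedSPD d) :
    DependsOn (· ∈ signs D.arrangement) {i | i ∈ D.edges} := by
  induction D with
  | edge i e =>
    intro s t h
    simp only [mem_signs_edge]
    rw [h i (by simp [edges])]
  | series D₁ D₂ h₁ h₂ =>
    intro s t h
    exact congrArg₂ And (h₁ fun i hi => h i (Multiset.mem_add.2 (Or.inl hi)))
      (h₂ fun i hi => h i (Multiset.mem_add.2 (Or.inr hi)))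
  | parallel D₁ D₂ h₁ h₂ =>
    intro s t h
    exact congrArg₂ Or (h₁ fun i hi => h i (Multiset.mem_add.2 (Or.inl hi)))
      (h₂ fun i hi => h i (Multiset.mem_add.2 (Or.inr hi)))

/-- The product of the signs at the labels of `D`. -/
def character (D : SignedSPD d) (s : Fin d → ℤˣ) : ℤ := ((D.edges.map s).prod : ℤˣ)

theorem dependsOn_character (D : SignedSPD d) : DependsOn D.character {i | i ∈ D.edges} := by
  intro s t h
  rw [character, character, Multiset.map_congr rfl h]

theorem character_mul {D D₁ D₂ : SignedSPD d} (h : D.edges = D₁.edges + D₂.edges)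
    (s : Fin d → ℤˣ) : D.character s = D₁.character s * D₂.character s := by
  simp [character, h]

open Classical in
/-- The character of `D`, cut off outside the arrangement of `D`. -/
noncomputable def weight (D : SignedSPD d) (s : Fin d → ℤˣ) : ℤ :=
  if s ∈ signs D.arrangement then D.character s else 0

theorem dependsOn_weight (D : SignedSPD d) : DependsOn D.weight {i | i ∈ D.edges} := by
  classical
  intro s t h
  have h1 : (s ∈ signs D.arrangement) = (t ∈ signs D.arrangement) := D.dependsOn_signs h
  rw [weight, weight, D.dependsOn_character h]
  simp only [h1]

theorem disjoint_edges {D₁ D₂ : SignedSPD d} (h : (D₁.edges + D₂.edges).Nodup) :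
    Disjoint {i | i ∈ D₁.edges} {i | i ∈ D₂.edges} :=
  Set.disjoint_left.2 fun _ h₁ h₂ =>
    Multiset.disjoint_left.1 (Multiset.nodup_add.1 h).2.2 h₁ h₂

theorem sum_mul_eq_zero {D₁ D₂ : SignedSPD d} {f g : (Fin d → ℤˣ) → ℤ}
    (h : (D₁.edges + D₂.edges).Nodup) (hf : DependsOn f {i | i ∈ D₁.edges})
    (hg : DependsOn g {i | i ∈ D₂.edges}) (h0 : ∑ s, g s = 0) : ∑ s, f s * g s = 0 := by
  have := card_mul_sum_mul_eq (disjoint_edges h) hf hg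
  rw [h0, mul_zero] at this
  simpa using this

theorem sum_character (D : SignedSPD d) (h : D.edges.Nodup) : ∑ s, D.character s = 0 := by
  induction D with
  | edge i e =>
    exact sum_eq_zero_of_flip i fun s => by simp [character, edges, flip_apply]
  | series D₁ D₂ _ h₂ =>
    simp only [character_mul (D := series D₁ D₂) rfl]
    exact sum_mul_eq_zero h D₁.dependsOn_character D₂.dependsOn_character
      (h₂ (Multiset.nodup_add.1 h).2.1)
  | parallel D₁ D₂ _ h₂ =>
    simp only [character_mul (D := parallel D₁ D₂) rfl]
    exact sum_mul_eq_zero h D₁.dependsOn_character D₂.dependsOn_character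
      (h₂ (Multiset.nodup_add.1 h).2.1)

/-- The average of the weight of a diagram without repeated labels is its signed volume, up to a
factor of `2` for each label: weights are independent under series connection, and for a parallel
connection inclusion-exclusion leaves only minus the product, since characters average to `0`. -/
theorem two_pow_mul_sum_weight (D : SignedSPD d) (h : D.edges.Nodup) :
    2 ^ D.edges.card * ∑ s, D.weight s = Fintype.card (Fin d → ℤˣ) * D.tau := by
  classical
  have key : ∀ D₁ D₂ : SignedSPD d, (D₁.edges + D₂.edges).Nodup →
      2 ^ D₁.edges.card * ∑ s, D₁.weight s = Fintype.card (Fin d → ℤˣ) * D₁.tau →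
      2 ^ D₂.edges.card * ∑ s, D₂.weight s = Fintype.card (Fin d → ℤˣ) * D₂.tau →
      2 ^ (D₁.edges + D₂.edges).card * ∑ s, D₁.weight s * D₂.weight s =
        Fintype.card (Fin d → ℤˣ) * (D₁.tau * D₂.tau) := by
    intro D₁ D₂ h h₁ h₂
    have hN : (Fintype.card (Fin d → ℤˣ) : ℤ) ≠ 0 := by positivity
    refine mul_left_cancel₀ hN ?_
    have := card_mul_sum_mul_eq (disjoint_edges h) D₁.dependsOn_weight D₂.dependsOn_weight
    rw [mul_left_comm, this, Multiset.card_add, pow_add]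
    linear_combination
      (2 ^ D₂.edges.card * ∑ s, D₂.weight s) * h₁ + (Fintype.card (Fin d → ℤˣ) * D₁.tau) * h₂
  induction D with
  | edge i e =>
    have h1 : ∀ s : Fin d → ℤˣ, 2 * (edge i e).weight s = (edge i e).character s + e := by
      intro s
      have hc : (edge i e).character s = s i := by simp [character, edges]
      rw [weight, hc]
      simp only [mem_signs_edge]
      rcases Int.units_eq_one_or (s i) with hs | hs <;>
        rcases Int.units_eq_one_or e with rfl | rfl <;> simp [hs]
    rw [show (edge i e).edges.card = 1 from rfl, pow_one, Finset.mul_sum]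
    simp only [h1, Finset.sum_add_distrib, sum_character _ h]
    simp [tau]
  | series D₁ D₂ h₁ h₂ =>
    obtain ⟨n₁, n₂, _⟩ := Multiset.nodup_add.1 h
    have hw : ∀ s, (series D₁ D₂).weight s = D₁.weight s * D₂.weight s := by
      intro s
      have hm : s ∈ signs (series D₁ D₂).arrangement ↔
        s ∈ signs D₁.arrangement ∧ s ∈ signs D₂.arrangement := Iff.rfl
      simp only [weight, hm, character_mul (D := series D₁ D₂) rfl]
      split_ifs <;> simp_all
    simp only [hw]
    exact key D₁ D₂ h (h₁ n₁) (h₂ n₂)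
  | parallel D₁ D₂ h₁ h₂ =>
    obtain ⟨n₁, n₂, _⟩ := Multiset.nodup_add.1 h
    have hw : ∀ s, (parallel D₁ D₂).weight s =
        D₁.weight s * D₂.character s + D₁.character s * D₂.weight s -
          D₁.weight s * D₂.weight s := by
      intro s
      have hm : s ∈ signs (parallel D₁ D₂).arrangement ↔
        s ∈ signs D₁.arrangement ∨ s ∈ signs D₂.arrangement := Iff.rfl
      simp only [weight, hm, character_mul (D := parallel D₁ D₂) rfl]
      split_ifs <;> simp_all
    have h' : (D₂.edges + D₁.edges).Nodup := by rw [add_comm]; exact h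
    have z₁ := sum_mul_eq_zero h D₁.dependsOn_weight D₂.dependsOn_character
      (sum_character D₂ n₂)
    have z₂ := sum_mul_eq_zero h' D₂.dependsOn_weight D₁.dependsOn_character
      (sum_character D₁ n₁)
    simp only [mul_comm (D₂.weight _)] at z₂
    simp only [hw, Finset.sum_add_distrib, Finset.sum_sub_distrib, z₁, z₂]
    have := key D₁ D₂ h (h₁ n₁) (h₂ n₂)
    simp only [edges, tau]
    linear_combination -this

/-- In a diagram with at least two labels, none repeated, fixing the sign at the label `j` to one
of its two values makes all labels of the sibling subtree of `j` irrelevant. -/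
theorem exists_isFree_half (D : SignedSPD d) (h : D.edges.Nodup) {j : Fin d} (hj : j ∈ D.edges) :
    (∃ e, D = edge j e) ∨
      ∃ σ, ∃ k ∈ D.edges, k ≠ j ∧ IsFree (half (signs D.arrangement) j σ) k := by
  have free : ∀ {D₁ D₂ : SignedSPD d}, (D₁.edges + D₂.edges).Nodup → ∀ {k}, k ∈ D₁.edges →
      IsFree (signs D₂.arrangement) k := fun h _ hk =>
    isFree_of_dependsOn (dependsOn_signs _) (Set.disjoint_left.1 (disjoint_edges h) hk)
  have ne : ∀ {D₁ D₂ : SignedSPD d}, (D₁.edges + D₂.edges).Nodup → ∀ {k j}, k ∈ D₁.edges →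
      j ∈ D₂.edges → k ≠ j := fun h _ _ hk hj hkj =>
    Set.disjoint_left.1 (disjoint_edges h) hk (hkj ▸ hj)
  have full : ∀ (i : Fin d) (e : ℤˣ), half (signs (edge i e).arrangement) i e = Set.univ := by
    intro i e
    ext s
    simp [half, mem_signs_edge]
  have void : ∀ (i : Fin d) (e : ℤˣ), half (signs (edge i e).arrangement) i (-e) = ∅ := by
    intro i e
    ext s
    simp [half, mem_signs_edge]
  have key : ∀ D₁ D₂ : SignedSPD d, (D₁.edges + D₂.edges).Nodup → j ∈ D₁.edges →
      ((∃ e, D₁ = edge j e) ∨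
        ∃ σ, ∃ k ∈ D₁.edges, k ≠ j ∧ IsFree (half (signs D₁.arrangement) j σ) k) →
      (∃ σ, ∃ k ∈ D₁.edges + D₂.edges, k ≠ j ∧
        IsFree (half (signs D₁.arrangement) j σ ∩ half (signs D₂.arrangement) j σ) k) ∧
      (∃ σ, ∃ k ∈ D₁.edges + D₂.edges, k ≠ j ∧
        IsFree (half (signs D₁.arrangement) j σ ∪ half (signs D₂.arrangement) j σ) k) := by
    rintro D₁ D₂ h hj (⟨e, rfl⟩ | ⟨σ, k, hk, hkj, hf⟩)
    · obtain ⟨k, hk⟩ := D₂.edges_ne_zero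
      have hk' : k ∈ (edge j e).edges + D₂.edges := Multiset.mem_add.2 (Or.inr hk)
      have hkj : k ≠ j := (ne h hj hk).symm
      refine ⟨⟨-e, k, hk', hkj, ?_⟩, ⟨e, k, hk', hkj, ?_⟩⟩
      · rw [void, Set.empty_inter]
        exact fun s hs => hs.elim
      · rw [full, Set.univ_union]
        exact fun _ _ _ => Set.mem_univ _
    · have hf' := (free h hk).half hkj σ
      have hk' : k ∈ D₁.edges + D₂.edges := Multiset.mem_add.2 (Or.inl hk)
      exact ⟨⟨σ, k, hk', hkj, hf.inter hf'⟩, ⟨σ, k, hk', hkj, hf.union hf'⟩⟩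
  induction D with
  | edge i e =>
    obtain rfl : j = i := by simpa [edges] using hj
    exact Or.inl ⟨e, rfl⟩
  | series D₁ D₂ h₁ h₂ =>
    obtain ⟨n₁, n₂, _⟩ := Multiset.nodup_add.1 h
    right
    rcases Multiset.mem_add.1 hj with hj | hj
    · exact (key D₁ D₂ h hj (h₁ n₁ hj)).1
    · obtain ⟨σ, k, hk, hkj, hf⟩ := (key D₂ D₁ (add_comm D₁.edges _ ▸ h) hj (h₂ n₂ hj)).1
      rw [Set.inter_comm] at hf
      exact ⟨σ, k, Multiset.mem_add.2 (Multiset.mem_add.1 hk).symm, hkj, hf⟩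
  | parallel D₁ D₂ h₁ h₂ =>
    obtain ⟨n₁, n₂, _⟩ := Multiset.nodup_add.1 h
    right
    rcases Multiset.mem_add.1 hj with hj | hj
    · exact (key D₁ D₂ h hj (h₁ n₁ hj)).2
    · obtain ⟨σ, k, hk, hkj, hf⟩ := (key D₂ D₁ (add_comm D₁.edges _ ▸ h) hj (h₂ n₂ hj)).2
      rw [Set.union_comm] at hf
      exact ⟨σ, k, Multiset.mem_add.2 (Multiset.mem_add.1 hk).symm, hkj, hf⟩

theorem tau_eq_one_or (D : SignedSPD d) : D.tau = 1 ∨ D.tau = -1 := by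
  induction D with
  | edge i e => rcases Int.units_eq_one_or e with rfl | rfl <;> simp [tau]
  | series D₁ D₂ h₁ h₂ => rcases h₁ with h₁ | h₁ <;> rcases h₂ with h₂ | h₂ <;> simp [tau, h₁, h₂]
  | parallel D₁ D₂ h₁ h₂ =>
    rcases h₁ with h₁ | h₁ <;> rcases h₂ with h₂ | h₂ <;> simp [tau, h₁, h₂]

end SignedSPD

/-- The signed volume of a floral vertex can be computed from any of its diagrams. -/
theorem SignedDiagram.IsFloralDiagramOf.tau_eq {D : SignedDiagram d} {α : Set (Fin d → ℝ)}
    (h : D.IsFloralDiagramOf α) (hα : IsLocalArrangement α) : D.tau = signedVolume α := by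
  classical
  obtain ⟨he, rfl⟩ := h
  cases D with
  | point =>
    have hd : d = 0 := by
      have := congrArg Multiset.card he
      simpa [SignedDiagram.edges] using this.symm
    subst hd
    simp [SignedDiagram.tau, signedVolume, SignedDiagram.arrangement]
  | proper D =>
    have he : D.edges = Finset.univ.val := he
    have h1 := D.two_pow_mul_sum_weight (he ▸ Finset.univ.nodup)
    have hc : D.edges.card = d := by rw [he]; simp
    have hN : (Fintype.card (Fin d → ℤˣ) : ℤ) = 2 ^ d := by
      simp [Fintype.card_units_int]
    rw [hc, hN] at h1
    rw [hα.signedVolume_eq]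
    refine (mul_left_cancel₀ (by positivity) h1).symm.trans (Finset.sum_congr rfl fun s _ => ?_)
    simp only [SignedSPD.weight, SignedSPD.character, he]
    rfl

theorem SignedDiagram.tau_eq_one_or (D : SignedDiagram d) : D.tau = 1 ∨ D.tau = -1 := by
  cases D with
  | point => exact Or.inl rfl
  | proper D => exact D.tau_eq_one_or

/-- One of the two sides of a floral vertex in any coordinate direction is degenerate. -/
theorem IsFloralVertex.exists_isThin {α : Set (Fin d → ℝ)} (h : IsFloralVertex α) (j : Fin d) :
    ∃ σ, IsThin (half (signs α) j σ) j := by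
  obtain ⟨D, he, rfl⟩ := h
  cases D with
  | point =>
    have : j ∈ (0 : Multiset (Fin d)) := by
      rw [show (0 : Multiset (Fin d)) = _ from he]; simp
    simp at this
  | proper D =>
    have he : D.edges = Finset.univ.val := he
    rcases D.exists_isFree_half (he ▸ Finset.univ.nodup) (j := j) (by rw [he]; simp) with
      ⟨e, rfl⟩ | ⟨σ, k, -, hkj, hf⟩
    · refine ⟨-e, Or.inl ?_⟩
      ext s
      simp [half, SignedDiagram.arrangement, SignedSPD.mem_signs_edge]
    · exact ⟨σ, Or.inr ⟨k, hkj, hf⟩⟩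

/-- Exactly one of the two sides of a floral vertex in any coordinate direction is nondegenerate:
if both were thin, the signed volume would vanish. -/
theorem IsFloralVertex.existsUnique_not_isThin {α : Set (Fin d → ℝ)} (h : IsFloralVertex α)
    (hα : IsLocalArrangement α) (j : Fin d) : ∃! σ, ¬ IsThin (half (signs α) j σ) j := by
  obtain ⟨σ, hσ⟩ := h.exists_isThin j
  obtain ⟨D, hD⟩ := h
  refine ⟨-σ, fun hσ' => ?_, fun ρ hρ => ?_⟩
  · have h1 := hα.signedVolume_eq_halfVolume j σ
    rw [halfVolume_eq_zero hσ, halfVolume_eq_zero hσ', ← hD.tau_eq hα] at h1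
    rcases D.tau_eq_one_or with h2 | h2 <;> simp [h2] at h1
  · exact Int.units_ne_iff_eq_neg.1 fun h => hρ (h ▸ hσ)

/-! ### Tangent cones at nearby points -/

/-- The sign of a nonzero real number; `0` gets the sign `-1`. -/
noncomputable def unitSign (r : ℝ) : ℤˣ := if 0 < r then 1 else -1

theorem eq_unitSign_of_nonneg {r : ℝ} (hr : r ≠ 0) {e : ℤˣ} :
    0 ≤ ((e : ℤ) : ℝ) * r ↔ e = unitSign r := by
  rcases Int.units_eq_one_or e with rfl | rfl <;> rcases hr.lt_or_gt with h | h <;>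
    simp [unitSign, h, h.le, h.not_gt]

theorem unitSign_neg {r : ℝ} (hr : r ≠ 0) : unitSign (-r) = -unitSign r := by
  rcases hr.lt_or_gt with h | h <;> simp [unitSign, h, h.not_gt]

theorem unitSign_eq_of_abs_lt {r t : ℝ} (h : |t| < |r|) : unitSign (r + t) = unitSign r := by
  have := abs_lt.1 h
  rcases le_or_gt 0 r with hr | hr
  · rw [abs_of_nonneg hr] at this
    rw [unitSign, unitSign, if_pos (by linarith), if_pos (by linarith)]
  · rw [abs_of_neg hr] at this
    rw [unitSign, unitSign, if_neg (by linarith), if_neg (by linarith)]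

theorem exists_mem_orthant (x : Fin d → ℝ) : ∃ s, x ∈ orthant s := by
  refine ⟨fun i => if 0 ≤ x i then 1 else -1, fun i => ?_⟩
  dsimp only
  split_ifs with h <;> simp <;> linarith

/-- The sign vector that agrees with the signs of `x` where these are determined, and with `s`
elsewhere. -/
noncomputable def merge (x : Fin d → ℝ) (s : Fin d → ℤˣ) : Fin d → ℤˣ :=
  fun i => if x i = 0 then s i else unitSign (x i)

/-- The tangent cone of the arrangement `α` at the point `x`. -/
noncomputable def coneAt (α : Set (Fin d → ℝ)) (x : Fin d → ℝ) : Set (Fin d → ℝ) :=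
  coneOf {s | merge x s ∈ signs α}

/-- For `y` small compared with the nonzero coordinates of `x`, the orthants that contain `x + y`
have the signs of `x` where `x` does not vanish and signs of `y` elsewhere. -/
theorem IsLocalArrangement.add_mem_iff {α : Set (Fin d → ℝ)} (h : IsLocalArrangement α)
    {x y : Fin d → ℝ} (hxy : ∀ i, x i ≠ 0 → |y i| < |x i|) : x + y ∈ α ↔ y ∈ coneAt α x := by
  have hne : ∀ i, x i ≠ 0 → x i + y i ≠ 0 := fun i hi h0 => by
    have := hxy i hi
    rw [eq_neg_of_add_eq_zero_right h0, abs_neg] at this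
    exact this.false
  rw [h.mem_iff, coneAt, mem_coneOf]
  constructor
  · rintro ⟨s, hs, hxs⟩
    obtain ⟨t, ht⟩ := exists_mem_orthant y
    refine ⟨fun i => if x i = 0 then s i else t i, ?_, fun i => ?_⟩
    · suffices hm : merge x (fun i => if x i = 0 then s i else t i) = s by
        change merge x _ ∈ signs α
        rwa [hm]
      ext1 i
      by_cases hi : x i = 0
      · simp [merge, hi]
      · have := (eq_unitSign_of_nonneg (hne i hi)).1 (hxs i)
        rw [unitSign_eq_of_abs_lt (hxy i hi)] at this
        simp [merge, hi, this]
    · by_cases hi : x i = 0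
      · simpa [hi] using hxs i
      · simpa [hi] using ht i
  · rintro ⟨s, hs, hys⟩
    refine ⟨merge x s, hs, fun i => ?_⟩
    by_cases hi : x i = 0
    · simpa [merge, hi] using hys i
    · refine (eq_unitSign_of_nonneg (hne i hi)).2 ?_
      rw [unitSign_eq_of_abs_lt (hxy i hi)]
      simp [merge, hi]

variable {P : Set (Fin d → ℝ)}

/-- Near `v`, the tangent cones of `P` are those of its tangent cone at `v`. -/
theorem IsTangentCone.coneAt {v : Fin d → ℝ} {α : Set (Fin d → ℝ)} (h : IsTangentCone P v α) :
    ∀ᶠ w in nhds v, IsTangentCone P w (coneAt α (w - v)) := by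
  obtain ⟨hα, δ, hδ, hP⟩ := h
  filter_upwards [Metric.ball_mem_nhds v (half_pos hδ)] with w hw
  set x := w - v with hx
  have hxδ : ∀ i, |x i| ≤ δ / 2 := fun i =>
    (norm_le_pi_norm x i).trans (by rw [hx, ← dist_eq_norm]; exact (Metric.mem_ball.1 hw).le)
  have hev : ∀ᶠ ε in nhdsWithin (0 : ℝ) (Set.Ioi 0), 0 < ε ∧ ε < δ / 2 ∧
      ∀ i, x i ≠ 0 → ε < |x i| := by
    refine Filter.Eventually.and self_mem_nhdsWithin (Filter.Eventually.and ?_ ?_)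
    · exact nhdsWithin_le_nhds (gt_mem_nhds (half_pos hδ))
    · refine Filter.eventually_all.2 fun i => ?_
      by_cases hi : x i = 0
      · simp [hi]
      · filter_upwards [nhdsWithin_le_nhds (gt_mem_nhds (abs_pos.2 hi))] with ε hε _ using hε
  obtain ⟨ε, hε, hεδ, hεx⟩ := hev.exists
  refine ⟨isLocalArrangement_coneOf _, ε, hε, fun y hy => ?_⟩
  rw [← hα.add_mem_iff fun i hi => (hy i).trans_lt (hεx i hi), ← hP]
  · rw [hx, ← add_assoc, add_sub_cancel]
  · intro i
    have := (abs_add_le (x i) (y i)).trans (add_le_add (hxδ i) (hy i))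
    rw [Pi.add_apply]
    linarith

namespace IsPureOrthogonalPolytope

theorem eventually_tangentCone_eq (hP : IsPureOrthogonalPolytope P) (v : Fin d → ℝ) :
    ∀ᶠ w in nhds v, tangentCone P w = coneAt (tangentCone P v) (w - v) :=
  (hP.isTangentCone v).coneAt.mono fun _ h => h.tangentCone_eq

theorem isLocalArrangement (hP : IsPureOrthogonalPolytope P) (v : Fin d → ℝ) :
    IsLocalArrangement (tangentCone P v) :=
  (hP.isTangentCone v).1

theorem mem_iff_nonempty (hP : IsPureOrthogonalPolytope P) {v : Fin d → ℝ} :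
    v ∈ P ↔ (tangentCone P v).Nonempty := by
  obtain ⟨hα, δ, hδ, h⟩ := hP.isTangentCone v
  have h0 := h 0 fun i => by simpa using hδ.le
  rw [add_zero] at h0
  rw [h0]
  refine ⟨fun h => ⟨0, h⟩, fun ⟨x, hx⟩ => ?_⟩
  obtain ⟨s, hs, -⟩ := hα.mem_iff.1 hx
  exact hα.mem_iff.2 ⟨s, hs, fun i => by simp⟩

theorem exists_bound (hP : IsPureOrthogonalPolytope P) : ∃ M : ℝ, ∀ x ∈ P, ∀ i, |x i| ≤ M := by
  obtain ⟨S, -, rfl⟩ := hP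
  have hb : Bornology.IsBounded (⋃ B ∈ S, Set.Icc B.1 B.2) :=
    (S.finite_toSet.isCompact_biUnion fun B _ => isCompact_Icc).isBounded
  obtain ⟨M, hM⟩ := hb.exists_norm_le
  exact ⟨M, fun x hx i => (norm_le_pi_norm x i).trans (hM x hx)⟩

end IsPureOrthogonalPolytope

/-! ### Essential coordinates -/

open Classical in
/-- The coordinates on which membership in `α` depends. -/
noncomputable def essential (α : Set (Fin d → ℝ)) : Finset (Fin d) :=
  Finset.univ.filter fun i => ¬ IsFree α i

theorem mem_essential {α : Set (Fin d → ℝ)} {i : Fin d} : i ∈ essential α ↔ ¬ IsFree α i := by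
  simp [essential]

theorem mem_of_eqOn_essential {α : Set (Fin d → ℝ)} {x y : Fin d → ℝ} (hx : x ∈ α)
    (h : ∀ i ∈ essential α, x i = y i) : y ∈ α := by
  refine IsFree.mem_of_eqOn (T := (essential α)ᶜ) (fun i hi => ?_) hx fun i hi => ?_
  · simpa [mem_essential] using hi
  · exact h i (by simpa using hi)

theorem IsLocalArrangement.coneAt_eq {α : Set (Fin d → ℝ)} (h : IsLocalArrangement α)
    {x : Fin d → ℝ} (hx : ∀ i ∈ essential α, x i = 0) : coneAt α x = α := by
  have : {s | merge x s ∈ signs α} = signs α := by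
    ext s
    have hs : ∀ i ∈ essential α, signPoint (merge x s) i = signPoint s i := fun i hi => by
      simp [signPoint, merge, hx i hi]
    exact ⟨fun hm => mem_of_eqOn_essential hm hs,
      fun hm => mem_of_eqOn_essential hm fun i hi => (hs i hi).symm⟩
  rw [coneAt, this, h.coneOf_signs]

/-- Passing to a nearby point loses the essential coordinates in which the point moves, and gains
none. -/
theorem essential_coneAt {α : Set (Fin d → ℝ)} (h : IsLocalArrangement α) {x : Fin d → ℝ}
    {i : Fin d} (hi : i ∈ essential (coneAt α x)) : i ∈ essential α ∧ x i = 0 := by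
  rw [mem_essential, coneAt, ← (isLocalArrangement_coneOf _).isFree_signs, signs_coneOf] at hi
  by_contra hc
  refine hi fun s hs e => ?_
  change merge x (update s i e) ∈ signs α
  by_cases hxi : x i = 0
  · have hf : IsFree (signs α) i := by
      rw [h.isFree_signs]
      by_contra hf
      exact hc ⟨mem_essential.2 hf, hxi⟩
    have : merge x (update s i e) = update (merge x s) i e := by
      ext k
      by_cases hk : k = i
      · subst hk; simp [merge, hxi]
      · simp [merge, hk]
    rw [this]
    exact hf _ hs e
  · have : merge x (update s i e) = merge x s := by
      ext k
      by_cases hk : k = i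
      · subst hk; simp [merge, hxi]
      · simp [merge, hk]
    rw [this]
    exact hs

theorem Congruent.refl (α : Set (Fin d → ℝ)) : Congruent α α :=
  ⟨1, 1, by simp⟩

/-- A signed permutation permutes the essential coordinates. -/
theorem Congruent.card_essential_eq {α β : Set (Fin d → ℝ)} (h : Congruent α β) :
    (essential α).card = (essential β).card := by
  obtain ⟨f, s, rfl⟩ := h
  set g : (Fin d → ℝ) → Fin d → ℝ := fun x i => ((s i : ℤ) : ℝ) * x (f i) with hg
  have hs : ∀ i, ((s i : ℤ) : ℝ) * ((s i : ℤ) : ℝ) = 1 := fun i => by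
    rcases Int.units_eq_one_or (s i) with h | h <;> simp [h]
  have hinj : Injective g := fun x y hxy => funext fun k => by
    have := congrFun hxy (f.symm k)
    simp only [hg, Equiv.apply_symm_apply] at this
    have h1 := congrArg (((s (f.symm k) : ℤ) : ℝ) * ·) this
    simpa [← mul_assoc, hs] using h1
  have hup : ∀ x i t, g (update x (f i) t) = update (g x) i (((s i : ℤ) : ℝ) * t) := by
    intro x i t
    ext k
    by_cases hk : k = i
    · subst hk; simp [hg]
    · simp [hg, hk]
  have hfree : ∀ i, IsFree (g '' α) i ↔ IsFree α (f i) := by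
    refine fun i => ⟨fun h x hx t => ?_, ?_⟩
    · have := h (g x) ⟨x, hx, rfl⟩ (((s i : ℤ) : ℝ) * t)
      rw [← hup] at this
      exact (hinj.mem_set_image).1 this
    · rintro h _ ⟨x, hx, rfl⟩ t
      refine ⟨update x (f i) (((s i : ℤ) : ℝ) * t), h x hx _, ?_⟩
      rw [hup, ← mul_assoc, hs, one_mul]
  refine (Finset.card_bij' (fun i _ => f i) (fun i _ => f.symm i) ?_ ?_ ?_ ?_).symm <;>
    simp [mem_essential, hfree]

/-! ### Genericity regions -/

/-- If moving by `x` does not lose essential coordinates in number, then `x` vanishes on the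
essential coordinates. -/
theorem eq_zero_of_card_essential_le {α : Set (Fin d → ℝ)} (h : IsLocalArrangement α)
    {x : Fin d → ℝ} (hx : (essential α).card ≤ (essential (coneAt α x)).card) :
    ∀ i ∈ essential α, x i = 0 := by
  have hsub : essential (coneAt α x) ⊆ essential α := fun i hi => (essential_coneAt h hi).1
  intro i hi
  rw [← Finset.eq_of_subset_of_card_le hsub hx] at hi
  exact (essential_coneAt h hi).2

/-- A path can stay in one congruence class only if its essential coordinates and its tangent cone
are locally constant, hence constant. -/
theorem constant_along_path (hP : IsPureOrthogonalPolytope P) {v w : Fin d → ℝ} (γ : Path v w)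
    (h : ∀ t, Congruent (tangentCone P v) (tangentCone P (γ t))) (t : unitInterval) :
    tangentCone P (γ t) = tangentCone P v ∧ ∀ i ∈ essential (tangentCone P v), γ t i = v i := by
  have loc : ∀ t, ∀ᶠ u in nhds t, tangentCone P (γ u) = tangentCone P (γ t) ∧
      ∀ i ∈ essential (tangentCone P (γ t)), γ u i = γ t i := by
    intro t
    filter_upwards [(γ.continuous.tendsto t).eventually (hP.eventually_tangentCone_eq (γ t))]
      with u hu
    have h0 := eq_zero_of_card_essential_le (hP.isLocalArrangement (γ t)) (x := γ u - γ t) (by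
      rw [← hu, ← (h t).card_essential_eq, ← (h u).card_essential_eq])
    exact ⟨hu.trans ((hP.isLocalArrangement _).coneAt_eq h0),
      fun i hi => sub_eq_zero.1 (h0 i hi)⟩
  have hC : ∀ t, tangentCone P (γ t) = tangentCone P v := by
    intro t
    have hlc : IsLocallyConstant fun t => tangentCone P (γ t) :=
      (IsLocallyConstant.iff_eventually_eq _).2 fun t => (loc t).mono fun _ hu => hu.1
    simpa using hlc.apply_eq_of_preconnectedSpace t 0
  refine ⟨hC t, fun i hi => ?_⟩
  have hlc : IsLocallyConstant fun t => γ t i :=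
    (IsLocallyConstant.iff_eventually_eq _).2 fun t => (loc t).mono fun _ hu =>
      hu.2 i (by rwa [hC])
  simpa using hlc.apply_eq_of_preconnectedSpace t 0

/-- On a path in a genericity region, tangent cones are equal and not just congruent. -/
theorem mem_genericityRegion (hP : IsPureOrthogonalPolytope P) {v w : Fin d → ℝ} (hv : v ∈ P) :
    w ∈ genericityRegion P v ↔ ∃ γ : Path v w, ∀ t, tangentCone P (γ t) = tangentCone P v := by
  refine exists_congr fun γ => ⟨fun h t => ?_, fun h t => ?_⟩
  · exact (constant_along_path hP γ (fun t => (h t).2) t).1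
  · rw [hP.mem_iff_nonempty, h, ← hP.mem_iff_nonempty]
    exact ⟨hv, Congruent.refl _⟩

theorem mem_genericityRegion_of_segment (hP : IsPureOrthogonalPolytope P) {v w : Fin d → ℝ}
    (hv : v ∈ P) (h : ∀ x ∈ segment ℝ v w, tangentCone P x = tangentCone P v) :
    w ∈ genericityRegion P v :=
  (mem_genericityRegion hP hv).2
    ⟨Path.segment v w, fun t => h _ (Path.range_segment v w ▸ ⟨t, rfl⟩)⟩

theorem eventually_tangentCone_eq_self (hP : IsPureOrthogonalPolytope P) (v : Fin d → ℝ) :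
    ∀ᶠ w in nhds v, (∀ i ∈ essential (tangentCone P v), w i = v i) →
      tangentCone P w = tangentCone P v := by
  filter_upwards [hP.eventually_tangentCone_eq v] with w hw h
  exact hw.trans ((hP.isLocalArrangement v).coneAt_eq fun i hi => sub_eq_zero.2 (h i hi))

/-- The degree of a genericity region is the number of inessential coordinates of its tangent
cone: the region is open in the hyperplane where the essential coordinates are fixed. -/
theorem regionDegree_genericityRegion (hP : IsPureOrthogonalPolytope P) {v : Fin d → ℝ}
    (hv : v ∈ P) :
    regionDegree (genericityRegion P v) = d - (essential (tangentCone P v)).card := by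
  refine IsLeast.csInf_eq ⟨⟨_, v, rfl, ?_⟩, ?_⟩
  · intro w hw i hi
    obtain ⟨γ, hγ⟩ := (mem_genericityRegion hP hv).1 hw
    have := (constant_along_path hP γ (fun t => by rw [hγ]; exact Congruent.refl _) 1).2 i hi
    simpa using this
  · rintro _ ⟨I, c, rfl, hI⟩
    refine Nat.sub_le_sub_left (Finset.card_le_card fun i hi => ?_) d
    by_contra hni
    obtain ⟨ε, hε, hball⟩ := Metric.eventually_nhds_iff_ball.1 (eventually_tangentCone_eq_self hP v)
    set w := update v i (v i + ε / 2) with hw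
    have hwε : w ∈ Metric.ball v ε := by
      rw [Metric.mem_ball, dist_pi_lt_iff hε]
      intro k
      by_cases hk : k = i
      · subst hk
        rw [hw, update_self, Real.dist_eq, add_sub_cancel_left, abs_of_pos (half_pos hε)]
        linarith
      · rw [hw, update_of_ne hk, dist_self]
        exact hε
    have hmem : w ∈ genericityRegion P v := by
      refine mem_genericityRegion_of_segment hP hv fun x hx => hball x
        ((convex_ball v ε).segment_subset (Metric.mem_ball_self hε) hwε hx) fun k hk => ?_
      have hki : k ≠ i := fun h => hni (h ▸ hk)
      obtain ⟨a, b, -, -, hab, rfl⟩ := hx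
      simp only [Pi.add_apply, Pi.smul_apply, smul_eq_mul, hw, update_of_ne hki]
      rw [← add_mul, hab, one_mul]
    have h1 := hI hmem i hi
    have h2 := hI ((mem_genericityRegion_of_segment hP hv) (by simp) :
      v ∈ genericityRegion P v) i hi
    rw [hw, update_self] at h1
    linarith

theorem mem_singularPoints (hP : IsPureOrthogonalPolytope P) {v : Fin d → ℝ} :
    v ∈ singularPoints P ↔ v ∈ P ∧ essential (tangentCone P v) = Finset.univ := by
  refine and_congr_right fun hv => ?_
  rw [regionDegree_genericityRegion hP hv, ← Finset.card_eq_iff_eq_univ, Fintype.card_fin]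
  have := Finset.card_le_univ (essential (tangentCone P v))
  rw [Fintype.card_fin] at this
  lia

/-! ### Edges -/

theorem eventually_tangentCone_update (hP : IsPureOrthogonalPolytope P) (v : Fin d → ℝ)
    (j : Fin d) (b : ℝ) : ∀ᶠ t in nhds b, tangentCone P (update v j t) =
      coneAt (tangentCone P (update v j b)) (Pi.single j (t - b)) := by
  have hc : Continuous fun t => update v j t := continuous_const.update j continuous_id
  filter_upwards [(hc.tendsto b).eventually (hP.eventually_tangentCone_eq _)] with t ht
  rw [ht]
  congr 1
  ext k
  by_cases hk : k = j
  · subst hk; simp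
  · simp [hk]

theorem signs_coneAt_single {α : Set (Fin d → ℝ)} {j : Fin d} {t : ℝ} (ht : t ≠ 0) :
    signs (coneAt α (Pi.single j t)) = half (signs α) j (unitSign t) := by
  rw [coneAt, signs_coneOf]
  ext s
  have : merge (Pi.single j t) s = update s j (unitSign t) := by
    ext k
    by_cases hk : k = j
    · subst hk; simp [merge, ht]
    · simp [merge, hk]
  change merge _ s ∈ signs α ↔ update s j _ ∈ signs α
  rw [this]

/-- A genericity region whose tangent cone has `j` as its only inessential coordinate is an open
segment in direction `j`, and its end points are singular. -/
theorem exists_genericityRegion_eq_openSegment (hP : IsPureOrthogonalPolytope P) {v : Fin d → ℝ}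
    (hv : v ∈ P) {j : Fin d} (hj : essential (tangentCone P v) = Finset.univ.erase j) :
    ∃ a b, a < v j ∧ v j < b ∧
      genericityRegion P v = openSegment ℝ (update v j a) (update v j b) ∧
      update v j a ∈ singularPoints P ∧ update v j b ∈ singularPoints P ∧
      ∀ t ∈ Set.Ioo a b, tangentCone P (update v j t) = tangentCone P v := by
  -- `U` collects all points of the line with the right tangent cone, `T` those reached from `v`
  -- inside `U`
  set U : Set ℝ := {t | tangentCone P (update v j t) = tangentCone P v} with hU
  set T : Set ℝ := U.ordConnectedComponent (v j) with hT
  have hvU : v j ∈ U := by simp [hU]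
  have hvT : v j ∈ T := Set.self_mem_ordConnectedComponent.2 hvU
  have hTU : T ⊆ U := Set.ordConnectedComponent_subset
  have hUo : IsOpen U := by
    refine isOpen_iff_mem_nhds.2 fun t ht => ?_
    have ht : tangentCone P (update v j t) = tangentCone P v := ht
    filter_upwards [eventually_tangentCone_update hP v j t] with u hu
    change tangentCone P (update v j u) = tangentCone P v
    rw [hu, (hP.isLocalArrangement _).coneAt_eq, ht]
    intro i hi
    rw [ht, hj] at hi
    exact Pi.single_eq_of_ne (Finset.ne_of_mem_erase hi) _
  have hTo : IsOpen T := by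
    refine isOpen_iff_mem_nhds.2 fun t ht => ?_
    have : T = U.ordConnectedComponent t := Set.ordConnectedComponent_eq ht
    rw [this]
    exact Set.ordConnectedComponent_mem_nhds.2 (hUo.mem_nhds (hTU ht))
  have hmemP : ∀ t ∈ U, update v j t ∈ P := fun t ht => by
    rw [hP.mem_iff_nonempty, show tangentCone P (update v j t) = _ from ht, ← hP.mem_iff_nonempty]
    exact hv
  obtain ⟨M, hM⟩ := hP.exists_bound
  have hTM : ∀ t ∈ T, -M ≤ t ∧ t ≤ M := fun t ht => by
    have := hM _ (hmemP t (hTU ht)) j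
    rw [update_self] at this
    exact abs_le.1 this
  have hbelow : BddBelow T := ⟨-M, fun t ht => (hTM t ht).1⟩
  have habove : BddAbove T := ⟨M, fun t ht => (hTM t ht).2⟩
  have hconn : IsConnected T := ⟨⟨_, hvT⟩, Set.OrdConnected.isPreconnected inferInstance⟩
  have hIoo : T = Set.Ioo (sInf T) (sSup T) := by
    refine Set.Subset.antisymm ?_ (hconn.Ioo_csInf_csSup_subset hbelow habove)
    have := interior_mono (subset_Icc_csInf_csSup hbelow habove)
    rwa [hTo.interior_eq, interior_Icc] at this
  have hab := hvT
  rw [hIoo] at hab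
  -- at a limit point of `T` outside `T` the coordinate `j` becomes essential
  have hend : ∀ b ∈ closure T, b ∉ T → update v j b ∈ singularPoints P := by
    intro b hb hbT
    obtain ⟨t, htT, ht⟩ := ((mem_closure_iff_frequently.1 hb).and_eventually
      (eventually_tangentCone_update hP v j b)).exists
    have htU := hTU htT
    have hsub : Finset.univ.erase j ⊆ essential (tangentCone P (update v j b)) := by
      intro i hi
      rw [← hj, ← (show tangentCone P (update v j t) = _ from htU), ht] at hi
      exact (essential_coneAt (hP.isLocalArrangement _) hi).1
    have hjb : j ∈ essential (tangentCone P (update v j b)) := by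
      by_contra hjb
      have hbU : b ∈ U := by
        change tangentCone P (update v j b) = tangentCone P v
        rw [← (show tangentCone P (update v j t) = _ from htU), ht,
          (hP.isLocalArrangement _).coneAt_eq]
        intro i hi
        refine Pi.single_eq_of_ne ?_ _
        rintro rfl
        exact hjb hi
      obtain ⟨u, huT, hub⟩ := ((mem_closure_iff_frequently.1 hb).and_eventually
        (Set.ordConnectedComponent_mem_nhds.2 (hUo.mem_nhds hbU))).exists
      exact hbT (Set.mem_ordConnectedComponent_trans huT (Set.mem_ordConnectedComponent_comm.1 hub))
    have huniv : essential (tangentCone P (update v j b)) = Finset.univ := by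
      rw [← Finset.insert_erase (Finset.mem_univ j)]
      exact Finset.Subset.antisymm
        (by rw [Finset.insert_erase (Finset.mem_univ j)]; exact Finset.subset_univ _)
        (Finset.insert_subset hjb hsub)
    refine (mem_singularPoints hP).2 ⟨?_, huniv⟩
    by_contra hbP
    rw [hP.mem_iff_nonempty, Set.not_nonempty_iff_eq_empty] at hbP
    rw [hbP, mem_essential] at hjb
    exact hjb fun x hx => hx.elim
  have hcl : closure T = Set.Icc (sInf T) (sSup T) := by
    rw [hIoo, closure_Ioo (hab.1.trans hab.2).ne, ← hIoo]
  have hle := (hab.1.trans hab.2).le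
  refine ⟨sInf T, sSup T, hab.1, hab.2, ?_, hend _ (hcl ▸ Set.left_mem_Icc.2 hle) ?_,
    hend _ (hcl ▸ Set.right_mem_Icc.2 hle) ?_, fun t ht => hTU (hIoo ▸ ht)⟩
  · rw [← Pi.image_update_openSegment, openSegment_eq_Ioo (hab.1.trans hab.2), ← hIoo]
    ext w
    constructor
    · intro hw
      obtain ⟨γ, hγ⟩ := (mem_genericityRegion hP hv).1 hw
      have hγv : ∀ t, γ t = update v j (γ t j) := fun t => by
        ext k
        by_cases hk : k = j
        · subst hk; simp
        · rw [update_of_ne hk]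
          exact (constant_along_path hP γ (fun t => by rw [hγ]; exact Congruent.refl _) t).2 k
            (by rw [hj]; simp [hk])
      refine ⟨w j, ?_, ?_⟩
      -- the `j`-th coordinates on the path fill the interval from `v j` to `w j`
      · have hpc : (Set.range fun t => γ t j).OrdConnected :=
          (isPreconnected_range ((continuous_apply j).comp γ.continuous)).ordConnected
        refine (hpc.uIcc_subset ⟨0, by simp⟩ ⟨1, by simp⟩).trans ?_
        rintro _ ⟨t, rfl⟩
        change tangentCone P (update v j (γ t j)) = tangentCone P v
        rw [← hγv, hγ]
      · have := hγv 1
        rw [γ.target] at this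
        exact this.symm
    · rintro ⟨t, ht, rfl⟩
      refine mem_genericityRegion_of_segment hP hv fun x hx => ?_
      have hx' : x ∈ segment ℝ (update v j (v j)) (update v j t) := by rwa [update_eq_self]
      rw [← Pi.image_update_segment, segment_eq_uIcc] at hx'
      obtain ⟨u, hu, rfl⟩ := hx'
      exact ht hu
  · rw [hIoo]
    simp [csInf_Ioo, hab.1.trans hab.2]
  · rw [hIoo]
    simp [csSup_Ioo, hab.1.trans hab.2]

/-! ### Edges at a vertex -/

/-- The points `p` and `w` differ exactly in the coordinate `j`, and along the open segment
between them the tangent cone of `P` is constant, with `j` as its only inessential coordinate. -/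
def JoinedAlong (P : Set (Fin d → ℝ)) (j : Fin d) (p w : Fin d → ℝ) : Prop :=
  w j ≠ p j ∧ (∀ i ≠ j, w i = p i) ∧ ∃ β : Set (Fin d → ℝ), β.Nonempty ∧
    essential β = Finset.univ.erase j ∧
      ∀ t ∈ openSegment ℝ (p j) (w j), tangentCone P (update p j t) = β

theorem update_eq_update_of_eq_off {j : Fin d} {p w : Fin d → ℝ} (h : ∀ i ≠ j, w i = p i) (t : ℝ) :
    update w j t = update p j t := by
  ext k
  by_cases hk : k = j
  · subst hk; simp
  · simp [hk, h k hk]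

namespace JoinedAlong

variable {j : Fin d} {p w : Fin d → ℝ}

theorem symm (h : JoinedAlong P j p w) : JoinedAlong P j w p := by
  obtain ⟨hne, hoff, β, hβ, hess, hcone⟩ := h
  refine ⟨hne.symm, fun i hi => (hoff i hi).symm, β, hβ, hess, fun t ht => ?_⟩
  rw [update_eq_update_of_eq_off hoff]
  exact hcone t (openSegment_symm ℝ (w j) (p j) ▸ ht)

theorem eq_update (h : JoinedAlong P j p w) : w = update p j (w j) := by
  rw [← update_eq_update_of_eq_off h.2.1, update_eq_self]

theorem notMem_singularPoints (hP : IsPureOrthogonalPolytope P) (h : JoinedAlong P j p w) {t : ℝ}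
    (ht : t ∈ openSegment ℝ (p j) (w j)) : update p j t ∉ singularPoints P := by
  obtain ⟨-, -, β, -, hess, hcone⟩ := h
  rw [mem_singularPoints hP, hcone t ht, hess]
  rintro ⟨-, hu⟩
  have := Finset.mem_univ j
  rw [← hu] at this
  simp at this

theorem eq_or_eq_of_mem_segment (hP : IsPureOrthogonalPolytope P) (h : JoinedAlong P j p w)
    {u : Fin d → ℝ} (hu : u ∈ singularPoints P) (hs : u ∈ segment ℝ p w) : u = p ∨ u = w := by
  have hs' : u ∈ segment ℝ (update p j (p j)) (update p j (w j)) := by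
    rwa [update_eq_self, ← h.eq_update]
  rw [← Pi.image_update_segment] at hs'
  obtain ⟨t, ht, rfl⟩ := hs'
  by_cases h1 : t = p j
  · left; rw [h1, update_eq_self]
  · by_cases h2 : t = w j
    · right; rw [h2, ← h.eq_update]
    · exact absurd hu (h.notMem_singularPoints hP
        (mem_openSegment_of_ne_left_right (Ne.symm h1) (Ne.symm h2) ht))

/-- The two end points of an edge see the same tangent cone along the edge, on opposite sides. -/
theorem exists_half_eq (hP : IsPureOrthogonalPolytope P) (h : JoinedAlong P j p w) :
    ∃ B : Set (Fin d → ℤˣ), ¬ IsThin B j ∧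
      half (signs (tangentCone P p)) j (unitSign (w j - p j)) = B ∧
      half (signs (tangentCone P w)) j (-unitSign (w j - p j)) = B := by
  have side : ∀ {p w : Fin d → ℝ} {β : Set (Fin d → ℝ)}, w j ≠ p j →
      (∀ t ∈ openSegment ℝ (p j) (w j), tangentCone P (update p j t) = β) →
      IsLocalArrangement β ∧
        half (signs (tangentCone P p)) j (unitSign (w j - p j)) = signs β := by
    intro p w β hne hcone
    have hcl : p j ∈ closure (openSegment ℝ (p j) (w j)) := by
      rw [closure_openSegment]
      exact left_mem_segment ℝ _ _
    obtain ⟨t, ht, hev⟩ := ((mem_closure_iff_frequently.1 hcl).and_eventually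
      (eventually_tangentCone_update hP p j (p j))).exists
    rw [hcone t ht, update_eq_self] at hev
    obtain ⟨a, b, ha, hb, hab, rfl⟩ := ht
    have hpos : a • p j + b • w j - p j = b * (w j - p j) := by
      rw [smul_eq_mul, smul_eq_mul]
      linear_combination (p j) * hab
    have hw : w j - p j ≠ 0 := sub_ne_zero.2 hne
    have hsign : unitSign (b * (w j - p j)) = unitSign (w j - p j) := by
      simp only [unitSign, mul_pos_iff_of_pos_left hb]
    refine ⟨hev ▸ isLocalArrangement_coneOf _, ?_⟩
    rw [hev, hpos, signs_coneAt_single (mul_ne_zero hb.ne' hw), hsign]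
  have hsymm := h.symm
  obtain ⟨hne, hoff, β, hβ, hess, hcone⟩ := h
  obtain ⟨hβl, h1⟩ := side hne hcone
  have h2 := (side hne.symm fun t ht => by
    rw [update_eq_update_of_eq_off hoff]
    exact hcone t (openSegment_symm ℝ (w j) (p j) ▸ ht)).2
  rw [← neg_sub, unitSign_neg (sub_ne_zero.2 hne)] at h2
  refine ⟨signs β, ?_, h1, h2⟩
  rintro (h0 | ⟨k, hk, hf⟩)
  · exact hβ.ne_empty (hβl.signs_eq_empty.1 h0)
  · rw [hβl.isFree_signs] at hf
    have : k ∈ essential β := by rw [hess]; simp [hk]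
    exact mem_essential.1 this hf

end JoinedAlong

theorem IsFace.exists_joinedAlong (hP : IsPureOrthogonalPolytope P) {E : Set (Fin d → ℝ)}
    (hE : IsFace P 1 E) : ∃ j, ∃ p ∈ singularPoints P, ∃ w ∈ singularPoints P,
      JoinedAlong P j p w ∧ E = segment ℝ p w := by
  obtain ⟨v, hv, hdeg, rfl⟩ := hE
  rw [regionDegree_genericityRegion hP hv] at hdeg
  have hcard : (essential (tangentCone P v))ᶜ.card = 1 := by
    rw [Finset.card_compl, Fintype.card_fin, hdeg]
  obtain ⟨j, hj⟩ := Finset.card_eq_one.1 hcard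
  have hess : essential (tangentCone P v) = Finset.univ.erase j := by
    rw [← compl_compl (essential _), hj]
    ext k
    simp
  obtain ⟨a, b, ha, hb, hR, hsa, hsb, hcone⟩ :=
    exists_genericityRegion_eq_openSegment hP hv hess
  refine ⟨j, _, hsa, _, hsb, ⟨?_, ?_, tangentCone P v, hP.mem_iff_nonempty.1 hv, hess, ?_⟩, ?_⟩
  · simpa using (ha.trans hb).ne'
  · intro i hi
    simp [hi]
  · intro t ht
    rw [update_self, update_self, openSegment_eq_Ioo (ha.trans hb)] at ht
    rw [update_idem]
    exact hcone t ht
  · rw [hR, closure_openSegment]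

theorem exists_joinedAlong_of_adj (hP : IsPureOrthogonalPolytope P) {v w : singularPoints P}
    (h : (skeleton P).Adj v w) : ∃ j, JoinedAlong P j v w := by
  obtain ⟨hne, E, hE, hv, hw⟩ := h
  obtain ⟨j, p, -, q, -, hpq, rfl⟩ := hE.exists_joinedAlong hP
  have hne' : (v : Fin d → ℝ) ≠ w := fun h => hne (Subtype.ext h)
  refine ⟨j, ?_⟩
  rcases hpq.eq_or_eq_of_mem_segment hP v.2 hv with h1 | h1 <;>
    rcases hpq.eq_or_eq_of_mem_segment hP w.2 hw with h2 | h2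
  · exact absurd (h1.trans h2.symm) hne'
  · rw [h1, h2]; exact hpq
  · rw [h1, h2]; exact hpq.symm
  · exact absurd (h1.trans h2.symm) hne'

/-- An edge leaves the singular point `p` on each side on which its tangent cone is
nondegenerate. -/
theorem exists_adj_of_not_isThin (hP : IsPureOrthogonalPolytope P) (p : singularPoints P)
    {j : Fin d} {σ : ℤˣ} (h : ¬ IsThin (half (signs (tangentCone P p)) j σ) j) :
    ∃ w : singularPoints P, (skeleton P).Adj p w ∧ JoinedAlong P j p w := by
  obtain ⟨p, hp⟩ := p
  change ¬ IsThin (half (signs (tangentCone P p)) j σ) j at h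
  obtain ⟨ε, hε, hball⟩ := Metric.eventually_nhds_iff_ball.1
    (eventually_tangentCone_update hP p j (p j))
  simp only [update_eq_self] at hball
  set β := coneOf (half (signs (tangentCone P p)) j σ)
  have hβl : IsLocalArrangement β := isLocalArrangement_coneOf _
  have hβs : signs β = half (signs (tangentCone P p)) j σ := signs_coneOf _
  have hβ : ∀ t, t ≠ p j → |t - p j| < ε → unitSign (t - p j) = σ →
      tangentCone P (update p j t) = β := by
    intro t ht htε hts
    have h1 := hball t (by rwa [Metric.mem_ball, Real.dist_eq])
    rw [← (hP.isLocalArrangement (update p j t)).coneOf_signs, h1,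
      signs_coneAt_single (sub_ne_zero.2 ht), hts]
  have hess : essential β = Finset.univ.erase j := by
    ext k
    rw [mem_essential, ← hβl.isFree_signs, hβs, Finset.mem_erase]
    refine ⟨fun hk => ⟨fun hkj => hk ?_, Finset.mem_univ k⟩, fun hk hf => h (Or.inr ⟨k, hk.1, hf⟩)⟩
    subst hkj
    intro s hs e
    change update (update s k e) k σ ∈ signs (tangentCone P p)
    rw [update_idem]
    exact hs
  have hβne : β.Nonempty := Set.nonempty_iff_ne_empty.2 fun h0 =>
    h (Or.inl (hβs ▸ hβl.signs_eq_empty.2 h0))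
  -- a point of the prospective edge
  set r : ℝ := ((σ : ℤ) : ℝ) * (ε / 2) with hr
  have hrabs : |r| = ε / 2 := by
    rw [hr, abs_mul, abs_of_pos (half_pos hε)]
    rcases Int.units_eq_one_or σ with h | h <;> simp [h]
  have hr0 : r ≠ 0 := abs_ne_zero.1 (by rw [hrabs]; exact (half_pos hε).ne')
  have hrs : unitSign r = σ := by
    rw [eq_comm, ← eq_unitSign_of_nonneg hr0, hr, ← mul_assoc]
    exact mul_nonneg (mul_self_nonneg _) (half_pos hε).le
  set q := update p j (p j + r) with hq
  have hqj : q j = p j + r := update_self ..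
  have hup : ∀ t, update q j t = update p j t := fun t => update_idem ..
  have hqβ : tangentCone P q = β := hβ _ (by simpa using hr0)
    (by rw [add_sub_cancel_left, hrabs]; linarith) (by rw [add_sub_cancel_left, hrs])
  have hqP : q ∈ P := by rw [hP.mem_iff_nonempty, hqβ]; exact hβne
  have hnβ : ∀ x, tangentCone P x = β → x ∉ singularPoints P := by
    intro x hx hs
    have h1 := ((mem_singularPoints hP).1 hs).2
    rw [hx, hess] at h1
    have := Finset.mem_univ j
    rw [← h1] at this
    simp at this
  have hface : IsFace P 1 (closure (genericityRegion P q)) := by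
    refine ⟨q, hqP, ?_, rfl⟩
    rw [regionDegree_genericityRegion hP hqP, hqβ, hess, Finset.card_erase_of_mem
      (Finset.mem_univ j), Finset.card_univ, Fintype.card_fin]
    have := j.pos
    lia
  obtain ⟨a, b, ha, hb, hR, hsa, hsb, hcone⟩ :=
    exists_genericityRegion_eq_openSegment hP hqP (hqβ ▸ hess)
  simp only [hup] at hR hsa hsb hcone
  rw [hqj] at ha hb
  rw [hqβ] at hcone
  rw [hR, closure_openSegment] at hface
  have hpu : update p j (p j) = p := update_eq_self ..
  -- there is no singular point strictly between `p` and `q`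
  have hend : p j = a ∨ p j = b := by
    by_contra! hc
    rcases hc.1.lt_or_gt with h1 | h1
    · have hr1 : 0 < r := by linarith
      refine hnβ _ (hβ a h1.ne' ?_ ?_) hsa
      · rw [abs_of_pos (by linarith)]
        rw [abs_of_pos hr1] at hrabs
        linarith
      · rw [← hrs, unitSign, unitSign, if_pos hr1, if_pos (by linarith)]
    · rcases hc.2.lt_or_gt with h2 | h2
      · refine hnβ p ?_ hp
        have := hcone (p j) ⟨h1, h2⟩
        rwa [hpu] at this
      · have hr1 : r < 0 := by linarith
        refine hnβ _ (hβ b h2.ne ?_ ?_) hsb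
        · rw [abs_of_neg (by linarith)]
          rw [abs_of_neg hr1] at hrabs
          linarith
        · rw [← hrs, unitSign, unitSign, if_neg hr1.not_gt, if_neg (by linarith)]
  have hab : a < b := ha.trans hb
  have hne : update p j a ≠ update p j b := fun h0 => hab.ne (by simpa using congrFun h0 j)
  have hoff : ∀ c, ∀ i ≠ j, update p j c i = p i := fun c i hi => update_of_ne hi ..
  rcases hend with hpa | hpb
  · have hpa' : p = update p j a := by rw [← hpa, hpu]
    refine ⟨⟨update p j b, hsb⟩, ⟨?_, _, hface, ?_, right_mem_segment ℝ _ _⟩, ?_, hoff b, β,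
      hβne, hess, fun t ht => hcone t ?_⟩
    · exact fun h0 => hne (hpa'.symm.trans (congrArg Subtype.val h0))
    · change p ∈ _
      rw [← hpa']
      exact left_mem_segment ℝ _ _
    · simpa [hpa] using hab.ne'
    · change t ∈ openSegment ℝ (p j) (update p j b j) at ht
      rwa [update_self, hpa, openSegment_eq_Ioo hab] at ht
  · have hpb' : p = update p j b := by rw [← hpb, hpu]
    refine ⟨⟨update p j a, hsa⟩, ⟨?_, _, hface, ?_, left_mem_segment ℝ _ _⟩, ?_, hoff a, β,
      hβne, hess, fun t ht => hcone t ?_⟩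
    · exact fun h0 => hne ((congrArg Subtype.val h0).symm.trans hpb')
    · change p ∈ _
      rw [← hpb']
      exact right_mem_segment ℝ _ _
    · simpa [hpb] using hab.ne
    · change t ∈ openSegment ℝ (p j) (update p j a j) at ht
      rwa [update_self, hpb, openSegment_symm, openSegment_eq_Ioo hab] at ht

/-- Two edges that leave `p` in the same direction agree, as neither contains a singular point in
its interior. -/
theorem JoinedAlong.eq_of_unitSign_eq (hP : IsPureOrthogonalPolytope P) {j : Fin d}
    {p w w' : Fin d → ℝ} (hw : w ∈ singularPoints P) (hw' : w' ∈ singularPoints P)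
    (h : JoinedAlong P j p w) (h' : JoinedAlong P j p w')
    (hs : unitSign (w j - p j) = unitSign (w' j - p j)) : w = w' := by
  have h1 : w j ∉ openSegment ℝ (p j) (w' j) := fun hm =>
    h'.notMem_singularPoints hP hm (h.eq_update ▸ hw)
  have h2 : w' j ∉ openSegment ℝ (p j) (w j) := fun hm =>
    h.notMem_singularPoints hP hm (h'.eq_update ▸ hw')
  rw [openSegment_eq_Ioo' h'.1.symm] at h1
  rw [openSegment_eq_Ioo' h.1.symm] at h2
  have h3 := h.1
  have h4 := h'.1
  have h5 : 0 < w j - p j ↔ 0 < w' j - p j := by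
    unfold unitSign at hs
    by_cases ha : 0 < w j - p j <;> by_cases hb : 0 < w' j - p j <;>
      simp only [ha, hb, if_true, if_false] at hs ⊢ <;> simp at hs
  suffices w j = w' j by rw [h.eq_update, h'.eq_update, this]
  simp only [Set.mem_Ioo, not_and_or, min_lt_iff, lt_max_iff] at h1 h2
  grind

/-! ### The skeleton of a generic orthotope -/

/-- Both signed volumes come from the halves that contain the common edge, and these halves are
equal but lie on opposite sides. -/
theorem signedVolume_add_eq_zero (hP : IsGenericOrthotope P) {v w : singularPoints P}
    (h : (skeleton P).Adj v w) :
    signedVolume (tangentCone P v) + signedVolume (tangentCone P w) = 0 := by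
  obtain ⟨j, hj⟩ := exists_joinedAlong_of_adj hP.1 h
  obtain ⟨B, hB, hv, hw⟩ := hj.exists_half_eq hP.1
  set σ := unitSign ((w : Fin d → ℝ) j - (v : Fin d → ℝ) j)
  have hσ : -σ ≠ σ := by rcases Int.units_eq_one_or σ with h | h <;> simp [h]
  have other : ∀ (u : singularPoints P) {ρ : ℤˣ}, half (signs (tangentCone P u)) j ρ = B →
      halfVolume (signs (tangentCone P u)) j (-ρ) = 0 := by
    intro u ρ hu
    refine halfVolume_eq_zero (by_contra fun hthin => ?_)
    have := ((hP.2 u u.2).existsUnique_not_isThin (hP.1.isLocalArrangement u) j).unique hthin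
      (hu ▸ hB)
    rcases Int.units_eq_one_or ρ with h | h <;> simp [h] at this
  rw [(hP.1.isLocalArrangement v).signedVolume_eq_halfVolume j σ,
    (hP.1.isLocalArrangement w).signedVolume_eq_halfVolume j (-σ), other v hv, other w hw,
    halfVolume_eq_neg (hv.trans hw.symm)]
  ring

/-- In each coordinate direction a vertex of a generic orthotope has exactly one neighbour. -/
theorem encard_neighborSet (hP : IsGenericOrthotope P) (v : singularPoints P) :
    ((skeleton P).neighborSet v).encard = d := by
  have hex : ∀ j, ∃ w : singularPoints P, (skeleton P).Adj v w ∧ JoinedAlong P j v w := fun j => by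
    obtain ⟨σ, hσ, -⟩ := (hP.2 v v.2).existsUnique_not_isThin (hP.1.isLocalArrangement v) j
    exact exists_adj_of_not_isThin hP.1 v hσ
  choose n hadj hn using hex
  have hinj : Injective n := fun i j hij => by
    by_contra hne
    have h1 := (hn j).2.1 i hne
    rw [← hij] at h1
    exact (hn i).1 h1
  have hrange : (skeleton P).neighborSet v = Set.range n := by
    ext w
    refine ⟨fun hw => ?_, ?_⟩
    · obtain ⟨j, hj⟩ := exists_joinedAlong_of_adj hP.1 hw
      obtain ⟨B, hB, h1, -⟩ := hj.exists_half_eq hP.1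
      obtain ⟨B', hB', h2, -⟩ := (hn j).exists_half_eq hP.1
      refine ⟨j, Subtype.ext ((hn j).eq_of_unitSign_eq hP.1 (n j).2 w.2 hj ?_)⟩
      exact ((hP.2 v v.2).existsUnique_not_isThin (hP.1.isLocalArrangement v) j).unique
        (h2 ▸ hB') (h1 ▸ hB)
    · rintro ⟨j, rfl⟩
      exact hadj j
  rw [hrange, ← Set.image_univ, hinj.encard_image]
  simp

theorem signedVolume_eq_one_or (hP : IsGenericOrthotope P) (v : singularPoints P) :
    signedVolume (tangentCone P v) = 1 ∨ signedVolume (tangentCone P v) = -1 := by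
  obtain ⟨D, hD⟩ := hP.2 v v.2
  rw [← hD.tau_eq (hP.1.isLocalArrangement v)]
  exact D.tau_eq_one_or

theorem isBipartiteWith_signedVolume (hP : IsGenericOrthotope P) :
    (skeleton P).IsBipartiteWith {v | signedVolume (tangentCone P v) = 1}
      {v | signedVolume (tangentCone P v) = -1} where
  disjoint := Set.disjoint_left.2 fun v (h1 : _ = _) (h2 : _ = _) => by
    rw [h1] at h2
    simp at h2
  mem_of_adj v w h := by
    have h0 := signedVolume_add_eq_zero hP h
    rcases signedVolume_eq_one_or hP v with h1 | h1
    · exact Or.inl ⟨h1, show _ = _ by linarith⟩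
    · exact Or.inr ⟨h1, show _ = _ by linarith⟩

end Orthotope

theorem mainTheorem6 (d : ℕ) (P : Set (Fin d → ℝ)) (hP : Orthotope.IsGenericOrthotope P) :
    -- the 1-dimensional faces and the vertices form a graph: each edge is a segment that
    -- joins two vertices and contains no other vertex
    (∀ E : Set (Fin d → ℝ), Orthotope.IsFace P 1 E →
      ∃ v w : Orthotope.singularPoints P, v ≠ w ∧ E = segment ℝ (v : Fin d → ℝ) w ∧
        ∀ u : Orthotope.singularPoints P, (u : Fin d → ℝ) ∈ E → u = v ∨ u = w) ∧
    -- it is regular of degree `d`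
    (∀ v : Orthotope.singularPoints P, ((Orthotope.skeleton P).neighborSet v).encard = d) ∧
    -- it is bipartite
    (Orthotope.skeleton P).IsBipartite ∧
    -- the signed volume of a vertex can be read off from any diagram of it, and is a sign
    (∀ (v : Orthotope.singularPoints P) (D : Orthotope.SignedDiagram d),
      D.IsFloralDiagramOf (Orthotope.tangentCone P v) →
        D.tau = Orthotope.signedVolume (Orthotope.tangentCone P v)) ∧
    (∀ v : Orthotope.singularPoints P,
      Orthotope.signedVolume (Orthotope.tangentCone P v) = 1 ∨
        Orthotope.signedVolume (Orthotope.tangentCone P v) = -1) ∧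
    -- adjacent vertices have opposite signed volumes, and the sign gives the bipartition
    (∀ v w : Orthotope.singularPoints P, (Orthotope.skeleton P).Adj v w →
      Orthotope.signedVolume (Orthotope.tangentCone P v) +
        Orthotope.signedVolume (Orthotope.tangentCone P w) = 0) ∧
    (Orthotope.skeleton P).IsBipartiteWith
      {v | Orthotope.signedVolume (Orthotope.tangentCone P v) = 1}
      {v | Orthotope.signedVolume (Orthotope.tangentCone P v) = -1} := by
  obtain ⟨hPo, -⟩ := id hP
  have hbip := Orthotope.isBipartiteWith_signedVolume hP
  refine ⟨fun E hE => ?_, Orthotope.encard_neighborSet hP,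
    SimpleGraph.isBipartite_iff_exists_isBipartiteWith.2 ⟨_, _, hbip⟩,
    fun v D hD => hD.tau_eq (hPo.isLocalArrangement v), Orthotope.signedVolume_eq_one_or hP,
    fun v w => Orthotope.signedVolume_add_eq_zero hP, hbip⟩
  obtain ⟨j, p, hp, w, hw, hpw, rfl⟩ := hE.exists_joinedAlong hPo
  exact ⟨⟨p, hp⟩, ⟨w, hw⟩, fun h => hpw.1 (congrFun (congrArg Subtype.val h) j).symm, rfl,
    fun u hu => (hpw.eq_or_eq_of_mem_segment hPo u.2 hu).imp Subtype.ext Subtype.ext⟩
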